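/- Let $\mathbf k$ be a field of characteristic zero and let $(V,d)$ be a finite-dimensional differential $\mathbb Z/2$-graded vector space over $\mathbf k$ ($d$ odd, $d^2=0$). Write $\Pi$ for parity reversion, $\hat S\,\Pi V^*$ for the completed free supercommutative algebra on $\Pi V^*$ (formal power series functions on $\Pi V$), $\hat S_{\ge n}$ for the combinations of monomials of length at least $n$, $\mathrm{Der}_{\ge n}$ for the derivations of $\hat S\,\Pi V^*$ that map $\Pi V^*$ into $\hat S_{\ge n}\Pi V^*$, and again $d$ for the derivation of $\hat S\,\Pi V^*$ induced by $d$. For $\xi=\sum_i f_i\partial_{z_i}$, where $z_i$ are homogeneous linear coordinates, let $\nabla\xi=\sum_i(-1)^{|f_i||z_i|}\partial_{z_i}f_i$ be its divergence. * An $L_\infty$ structure on $V$ is an odd $m\in\mathrm{Der}_{\ge 2}(\hat S\,\Pi V^*)$ with $d(m)+\tfrac12[m,m]=0$. A unimodular lift of it is an even $f\in\hat S_{\ge1}\Pi V^*$ with $d(f)+\tfrac12\nabla(m)+m(f)=0$. * The space $V\oplus\Pi V^*$ carries the differential given by $d$ on $V$ and the parity shift of the dual of $d$ on $\Pi V^*$,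 and the odd symmetric form for which $V$ and $\Pi V^*$ are isotropic and $\langle v,\Pi\varphi\rangle=\varphi(v)$. The functions on $\Pi(V\oplus\Pi V^*)$ are $\hat S(\Pi V^*\oplus V)$. If $z_i$ is a homogeneous basis of $\Pi V^*$ and $p_i\in V$ is the parity-shifted dual basis, let $\{\,,\}$ be the odd Poisson bracket on $\hat S(\Pi V^*\oplus V)$ with $\{p_i,z_j\}=\delta_{ij}$ and $\{z_i,z_j\}=\{p_i,p_j\}=0$, satisfying $\{f,g\}=(-1)^{|f||g|}\{g,f\}$ and $\{f,gh\}=\{f,g\}h+(-1)^{(|f|+1)|g|}g\{f,h\}$. Put $X_g=\{g,\cdot\}$ and $\Delta(g)=\tfrac12\nabla(X_g)$. * The odd double of $(V,m)$ is $V\oplus\Pi V^*$ with the odd cyclic $L_\infty$ structure $X_{D(m)}$, where $D(m)=\sum_i(-1)^{|m(z_i)|}m(z_i)\,p_i$. * A quantum lift of an odd cyclic $L_\infty$ structure $m'$ on $V\oplus\Pi V^*$ is an even series $S=S_0+hS_1+h^2S_2+\cdots\in\hat S(\Pi V^*\oplus V)[[h]]$ all of whose monomials $h^g f$ satisfy $2g+\operatorname{length}(f)>2$,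 with $X_{S_0}=m'$ and $(d+h\Delta)S+\tfrac12\{S,S\}=0$. **Theorem.** Let $m$ be an $L_\infty$ structure on $V$. The following are equivalent: 1. $(V,m)$ admits a unimodular lift; 2. the odd double $(V\oplus\Pi V^*,X_{D(m)})$ admits a unimodular lift; 3. the odd double $(V\oplus\Pi V^*,X_{D(m)})$ admits a quantum lift. -/

import Mathlib

open scoped ExteriorAlgebra

noncomputable section

namespace LInf

/-! ### Formal functions on the parity reversion of a super vector space

`V = V₀ ⊕ V₁` is a finite-dimensional super vector space with a homogeneous basis: `ι` indexes the
basis of the even part, `κ` the basis of the odd part. The coordinate functions on `ΠV` dual to the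
basis of `V₁` are even (`x j`, `j : κ`), those dual to the basis of `V₀` are odd (`y i`, `i : ι`).
The complete free supercommutative algebra `Ŝ ΠV*` is the algebra of power series in the even
coordinates with coefficients in the exterior algebra on the odd coordinates. -/

/-- The algebra `Ŝ ΠV*`, for `V` of dimension `ι | κ`. -/
abbrev FormalFun (k ι κ : Type*) [Field k] : Type _ :=
  MvPowerSeries κ (ExteriorAlgebra k (ι → k))

section Functions

variable {k ι κ : Type*} [Field k]

/-- A linear operator on the exterior algebra, applied to each coefficient. -/
def coeffwise (L : ExteriorAlgebra k (ι → k) →ₗ[k] ExteriorAlgebra k (ι → k)) :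
    FormalFun k ι κ →ₗ[k] FormalFun k ι κ where
  toFun f := fun a => L (MvPowerSeries.coeff a f)
  map_add' f g := by
    funext a
    exact (congrArg L (map_add (MvPowerSeries.coeff a) f g)).trans (map_add L _ _)
  map_smul' c f := by
    funext a
    exact map_smul L c (MvPowerSeries.coeff a f)

/-- The parity involution `f ↦ (-1)^|f| f`. -/
def par : FormalFun k ι κ →ₗ[k] FormalFun k ι κ :=
  coeffwise (CliffordAlgebra.involute (Q := (0 : QuadraticForm k (ι → k)))).toLinearMap

/-- Even functions. -/
def IsEvenFun (f : FormalFun k ι κ) : Prop := par f = f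

/-- `Ŝ_{≥ n} ΠV*`: the (possibly infinite) combinations of monomials of length at least `n`. The
length of a monomial is its degree in the even coordinates plus its degree in the odd ones. -/
def orderGE (n : ℕ) : Submodule k (FormalFun k ι κ) where
  carrier := {f | ∀ a : κ →₀ ℕ,
    MvPowerSeries.coeff a f ∈ ⨆ (j : ℕ) (_ : n ≤ a.degree + j), ⋀[k]^j (ι → k)}
  add_mem' {f g} hf hg a := by
    rw [map_add]
    exact Submodule.add_mem _ (hf a) (hg a)
  zero_mem' a := by
    rw [map_zero]
    exact Submodule.zero_mem _
  smul_mem' c f hf a := Submodule.smul_mem _ c (hf a)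

/-- The even coordinate function `x j`. -/
def evenCoord (j : κ) : FormalFun k ι κ := MvPowerSeries.X j

/-- The odd coordinate function `y i`. -/
def oddCoord [DecidableEq ι] (i : ι) : FormalFun k ι κ :=
  MvPowerSeries.C (ExteriorAlgebra.ι k (Pi.single i (1 : k)))

/-- The partial derivative along an even coordinate. -/
def evenDeriv (j : κ) : FormalFun k ι κ →ₗ[k] FormalFun k ι κ where
  toFun f := fun a => ((a j : k) + 1) • MvPowerSeries.coeff (a + Finsupp.single j 1) f
  map_add' f g := by
    funext a
    exact (congrArg (((a j : k) + 1) • ·)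
      (map_add (MvPowerSeries.coeff (a + Finsupp.single j 1)) f g)).trans (smul_add _ _ _)
  map_smul' c f := by
    funext a
    exact smul_comm ((a j : k) + 1) c (MvPowerSeries.coeff (a + Finsupp.single j 1) f)

/-- The (left) partial derivative along an odd coordinate: the contraction, which satisfies
`∂ᵢ (yⱼ g) = δᵢⱼ g - yⱼ ∂ᵢ g`. -/
def oddDeriv (i : ι) : FormalFun k ι κ →ₗ[k] FormalFun k ι κ :=
  coeffwise (CliffordAlgebra.contractLeft (Q := (0 : QuadraticForm k (ι → k)))
    (LinearMap.proj i : (ι → k) →ₗ[k] k))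

/-! ### Formal vector fields -/

/-- `D` is an odd derivation of `Ŝ ΠV*`. (Derivations of this algebra are automatically
continuous.) -/
structure IsOddDerivation (D : FormalFun k ι κ →ₗ[k] FormalFun k ι κ) : Prop where
  odd : ∀ f, D (par f) = -par (D f)
  leibniz : ∀ f g, D (f * g) = D f * g + par f * D g

/-- `D` takes the coordinate functions, hence `ΠV*`, to `Ŝ_{≥ n} ΠV*`. A derivation with this
property belongs to `Der_{≥ n}`; so `m` in `Der_{≥ 2}` has components `m₂, m₃, …`. -/
def DerGE [DecidableEq ι] (n : ℕ) (D : FormalFun k ι κ →ₗ[k] FormalFun k ι κ) : Prop :=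
  (∀ j : κ, D (evenCoord j) ∈ orderGE n) ∧ ∀ i : ι, D (oddCoord i) ∈ orderGE n

/-- The vector field `∑ j, c j ∂/∂xⱼ + ∑ i, e i ∂/∂yᵢ`. -/
def vectorField [Fintype ι] [Fintype κ] (c : κ → FormalFun k ι κ) (e : ι → FormalFun k ι κ) :
    FormalFun k ι κ →ₗ[k] FormalFun k ι κ :=
  ∑ j, LinearMap.mulLeft k (c j) ∘ₗ evenDeriv j + ∑ i, LinearMap.mulLeft k (e i) ∘ₗ oddDeriv i

/-- The divergence `∑ (-1)^(|f_z||z|) ∂f_z/∂z` of `ξ = ∑ f_z ∂/∂z`, where `z` runs over all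
coordinates and `f_z = ξ z`. -/
def divergence [Fintype ι] [Fintype κ] [DecidableEq ι]
    (ξ : FormalFun k ι κ →ₗ[k] FormalFun k ι κ) : FormalFun k ι κ :=
  ∑ j, evenDeriv j (ξ (evenCoord j)) + ∑ i, oddDeriv i (par (ξ (oddCoord i)))

end Functions

/-! ### Differential graded vector spaces, `L∞` structures and unimodular `L∞` structures -/

/-- A differential on the super vector space `V₀ ⊕ V₁`: an odd endomorphism of square zero. -/
structure Differential (k V₀ V₁ : Type*) [Field k] [AddCommGroup V₀] [Module k V₀]
    [AddCommGroup V₁] [Module k V₁] where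
  d₀ : V₀ →ₗ[k] V₁
  d₁ : V₁ →ₗ[k] V₀
  d₁_d₀ : ∀ v, d₁ (d₀ v) = 0
  d₀_d₁ : ∀ v, d₀ (d₁ v) = 0

section Structures

variable {k ι κ V₀ V₁ : Type*} [Field k] [AddCommGroup V₀] [Module k V₀]
  [AddCommGroup V₁] [Module k V₁] [Fintype ι] [Fintype κ] [DecidableEq ι]

/-- The Lie derivative along the linear vector field `d`: the odd derivation of `Ŝ ΠV*` that takes
a coordinate function `z` to the linear function `z ∘ d`. -/
def lieD (d : Differential k V₀ V₁) (b₀ : Module.Basis ι k V₀) (b₁ : Module.Basis κ k V₁) :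
    FormalFun k ι κ →ₗ[k] FormalFun k ι κ :=
  vectorField (fun j => ∑ i, b₁.coord j (d.d₀ (b₀ i)) • oddCoord i)
    (fun i => ∑ j, b₀.coord i (d.d₁ (b₁ j)) • evenCoord j)

/-- `m` is an `L∞` structure on `(V, d)`: an odd element of `Der_{≥ 2}(Ŝ ΠV*)` such that
`d(m) + ½[m, m] = 0`. As `d` and `m` are odd, `d(m) = dm + md` and `½[m, m] = m²`. -/
structure IsLInfinity (d : Differential k V₀ V₁) (b₀ : Module.Basis ι k V₀)
    (b₁ : Module.Basis κ k V₁) (m : FormalFun k ι κ →ₗ[k] FormalFun k ι κ) : Prop where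
  derivation : IsOddDerivation m
  order : DerGE 2 m
  maurerCartan : lieD d b₀ b₁ ∘ₗ m + m ∘ₗ lieD d b₀ b₁ + m ∘ₗ m = 0

/-- `(m, f)` is a unimodular `L∞` structure on `(V, d)`: `m` is an `L∞` structure, `f` is an even
function in `Ŝ_{≥ 1} ΠV*` and `d(f) + ½ ∇(m) + m(f) = 0`. -/
structure IsUnimodular (d : Differential k V₀ V₁) (b₀ : Module.Basis ι k V₀)
    (b₁ : Module.Basis κ k V₁) (m : FormalFun k ι κ →ₗ[k] FormalFun k ι κ)
    (f : FormalFun k ι κ) : Prop where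
  lInfinity : IsLInfinity d b₀ b₁ m
  even : IsEvenFun f
  order : f ∈ orderGE 1
  equation : lieD d b₀ b₁ f + (1 / 2 : k) • divergence m + m f = 0

/-- The `L∞` structure `m` admits a unimodular lift. -/
def HasUnimodularLift (d : Differential k V₀ V₁) (b₀ : Module.Basis ι k V₀)
    (b₁ : Module.Basis κ k V₁) (m : FormalFun k ι κ →ₗ[k] FormalFun k ι κ) : Prop :=
  ∃ f, IsUnimodular d b₀ b₁ m f

end Structures

/-! ### The antibracket, the Laplacian and quantum `L∞` structures

Here `W = W₀ ⊕ W₁` carries an odd symmetric non-degenerate form, and the bases of `W₀` and `W₁`,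
indexed by the same type `τ`, are dual to each other under this form (a Darboux basis). So the odd
coordinate `y a` and the even coordinate `x a` on `ΠW` are conjugate. -/

section Quantum

variable {k τ : Type*} [Field k] [Fintype τ] [DecidableEq τ]

/-- The vector field `X_f = {f, ·}` of a Hamiltonian `f`, where
`{f, g} = ∑ₐ ((∂f/∂yₐ) (∂g/∂xₐ) + (-1)^|f| (∂f/∂xₐ) (∂g/∂yₐ))`. This is the odd Poisson bracket with
`{yₐ, x_b} = {x_b, yₐ} = δ_ab`, with `{f, g} = (-1)^(|f||g|) {g, f}` and with
`{f, gh} = {f, g} h + (-1)^((|f|+1)|g|) g {f, h}`. -/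
def hamiltonian (f : FormalFun k τ τ) : FormalFun k τ τ →ₗ[k] FormalFun k τ τ :=
  vectorField (fun a => oddDeriv a f) (fun a => evenDeriv a (par f))

/-- The odd Poisson bracket (antibracket) `{f, g}`. -/
def antibracket (f g : FormalFun k τ τ) : FormalFun k τ τ := hamiltonian f g

/-- The odd Laplacian `Δ(g) = ½ ∇(X_g)`. -/
def laplacian (g : FormalFun k τ τ) : FormalFun k τ τ := (1 / 2 : k) • divergence (hamiltonian g)

/-- The antibracket, extended to formal power series in the (even, central) variable `h`. -/
def antibracketH (S T : PowerSeries (FormalFun k τ τ)) : PowerSeries (FormalFun k τ τ) :=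
  PowerSeries.mk fun n => ∑ p ∈ Finset.HasAntidiagonal.antidiagonal n,
    antibracket (PowerSeries.coeff p.1 S) (PowerSeries.coeff p.2 T)

variable {W₀ W₁ : Type*} [AddCommGroup W₀] [Module k W₀] [AddCommGroup W₁] [Module k W₁]

/-- `S = S₀ + h S₁ + h² S₂ + ⋯` is a quantum `L∞` structure on `(W, d)`: it is even, it contains only
monomials `h^g f` of weight `2 g + (length of f) > 2`, and it satisfies the quantum master equation
`(d + hΔ) S + ½ {S, S} = 0`. In the weight condition the subtraction is that of natural numbers:
there is no condition on `S_g` for `g ≥ 2`. -/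
structure IsQuantum (d : Differential k W₀ W₁) (b₀ : Module.Basis τ k W₀)
    (b₁ : Module.Basis τ k W₁) (S : PowerSeries (FormalFun k τ τ)) : Prop where
  even : ∀ g, IsEvenFun (PowerSeries.coeff g S)
  weight : ∀ g, PowerSeries.coeff g S ∈ orderGE (3 - 2 * g)
  master : PowerSeries.mk (fun n => lieD d b₀ b₁ (PowerSeries.coeff n S))
    + PowerSeries.X * PowerSeries.mk (fun n => laplacian (PowerSeries.coeff n S))
    + (1 / 2 : k) • antibracketH S S = 0

/-- The odd cyclic `L∞` structure `m` admits a quantum lift: a quantum `L∞` structure `S` whose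
genus zero part `S₀` has Hamiltonian vector field `m`. -/
def HasQuantumLift (d : Differential k W₀ W₁) (b₀ : Module.Basis τ k W₀)
    (b₁ : Module.Basis τ k W₁) (m : FormalFun k τ τ →ₗ[k] FormalFun k τ τ) : Prop :=
  ∃ S, IsQuantum d b₀ b₁ S ∧ hamiltonian (PowerSeries.coeff 0 S) = m

end Quantum

/-! ### The odd double

The odd double of `V` is `V ⊕ ΠV*`, with even part `V₀ ⊕ V₁*` and odd part `V₁ ⊕ V₀*`. -/

section Double

variable {k ι κ V₀ V₁ : Type*} [Field k] [AddCommGroup V₀] [Module k V₀]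
  [AddCommGroup V₁] [Module k V₁]

/-- The differential of `V ⊕ ΠV*`: that of `V` on `V`, and on `ΠV*` the parity shift of the dual one,
`d(Πφ) = -Π(dφ)` with `dφ = -(-1)^|φ| φ ∘ d`. -/
def doubleDifferential (d : Differential k V₀ V₁) :
    Differential k (V₀ × Module.Dual k V₁) (V₁ × Module.Dual k V₀) where
  d₀ := d.d₀.prodMap (-d.d₀.dualMap)
  d₁ := d.d₁.prodMap d.d₁.dualMap
  d₁_d₀ v := by
    refine Prod.ext (d.d₁_d₀ v.1) (LinearMap.ext fun w => ?_)
    simp [d.d₀_d₁]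
  d₀_d₁ v := by
    refine Prod.ext (d.d₀_d₁ v.1) (LinearMap.ext fun w => ?_)
    simp [d.d₁_d₀]

/-- The odd symmetric form on `V ⊕ ΠV*`, for which `V` and `ΠV*` are isotropic and
`⟨v, Πφ⟩ = ⟨Πφ, v⟩ = φ v`; here as a pairing of the even part with the odd part. -/
def doubleForm (u : V₀ × Module.Dual k V₁) (w : V₁ × Module.Dual k V₀) : k :=
  w.2 u.1 + u.2 w.1

/-- The form is compatible with the differential, `⟨du, v⟩ + (-1)^|u| ⟨u, dv⟩ = 0`: even vectors. -/
theorem doubleForm_d₀ (d : Differential k V₀ V₁) (u v : V₀ × Module.Dual k V₁) :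
    doubleForm v ((doubleDifferential d).d₀ u) + doubleForm u ((doubleDifferential d).d₀ v) = 0 := by
  simp [doubleForm, doubleDifferential]

/-- The form is compatible with the differential, `⟨du, v⟩ + (-1)^|u| ⟨u, dv⟩ = 0`: odd vectors. -/
theorem doubleForm_d₁ (d : Differential k V₀ V₁) (u v : V₁ × Module.Dual k V₀) :
    doubleForm ((doubleDifferential d).d₁ u) v - doubleForm ((doubleDifferential d).d₁ v) u = 0 := by
  simp [doubleForm, doubleDifferential]
  ring

variable [Fintype ι] [Fintype κ] [DecidableEq ι] [DecidableEq κ]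

/-- The basis of the even part `V₀ ⊕ V₁*` of the odd double. -/
def doubleBasis₀ (b₀ : Module.Basis ι k V₀) (b₁ : Module.Basis κ k V₁) :
    Module.Basis (ι ⊕ κ) k (V₀ × Module.Dual k V₁) :=
  b₀.prod b₁.dualBasis

/-- The basis of the odd part `V₁ ⊕ V₀*` of the odd double, indexed so that `inl i` stands for the
dual basis vector `(b₀ i)*` and `inr j` for `b₁ j`. -/
def doubleBasis₁ (b₀ : Module.Basis ι k V₀) (b₁ : Module.Basis κ k V₁) :
    Module.Basis (ι ⊕ κ) k (V₁ × Module.Dual k V₀) :=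
  (b₁.prod b₀.dualBasis).reindex (Equiv.sumComm κ ι)

/-- The two bases of the odd double are dual to each other under its odd form. -/
theorem doubleForm_basis (b₀ : Module.Basis ι k V₀) (b₁ : Module.Basis κ k V₁) (s t : ι ⊕ κ) :
    doubleForm (doubleBasis₀ b₀ b₁ s) (doubleBasis₁ b₀ b₁ t) = if s = t then 1 else 0 := by
  rcases s with i | j <;> rcases t with i' | j' <;>
    simp [doubleForm, doubleBasis₀, doubleBasis₁, Finsupp.single_apply, eq_comm]

/-- The inclusion `Ŝ ΠV* ⊆ Ŝ(ΠV* ⊕ V)` of the functions on `ΠV` in those on `Π(V ⊕ ΠV*)`. It takes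
`x j` to the even coordinate `inr j`, and `y i` to the odd coordinate `inl i`. -/
def incl (f : FormalFun k ι κ) : FormalFun k (ι ⊕ κ) (ι ⊕ κ) := fun a =>
  if ∀ i : ι, a (Sum.inl i) = 0 then
    ExteriorAlgebra.map (LinearMap.pi (Sum.elim (fun i => LinearMap.proj i) fun _ => 0))
      (MvPowerSeries.coeff (a.comapDomain Sum.inr Sum.inr_injective.injOn) f)
  else 0

/-- The odd doubling map, `f ∂/∂z ↦ (-1)^|f| f Πz*` for each coordinate `z` on `ΠV`. The function
`Πz*` is the coordinate conjugate to `z`: the odd coordinate `inr j` for `z = x j`, and the even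
coordinate `inl i` for `z = y i`. -/
def oddDouble (m : FormalFun k ι κ →ₗ[k] FormalFun k ι κ) : FormalFun k (ι ⊕ κ) (ι ⊕ κ) :=
  ∑ j, incl (par (m (evenCoord j))) * oddCoord (Sum.inr j)
    + ∑ i, incl (par (m (oddCoord i))) * evenCoord (Sum.inl i)

end Double

end LInf

end

open scoped ExteriorAlgebra

noncomputable section

namespace LInf

/-! ### Exterior algebra -/

section Exterior

variable {k M N : Type*} [Field k] [AddCommGroup M] [Module k M] [AddCommGroup N] [Module k N]

/-! The odd double is a shifted cotangent bundle: `inclL` pulls functions back from the base `ΠV`,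
and `restrict` evaluates them on the zero section, where all momenta vanish. The Hamiltonian `D(m)`
is linear in the momenta, and its field is the cotangent lift of `m`. This gives three facts. The
lift acts on pulled-back functions as `m` (`hamiltonian_oddDouble_inclL`). It is tangent to the zero
section and induces `m` there (`restrict_hamiltonian_oddDouble`). Finally, `Δ D(m)` is the pullback
of the whole divergence `∇m`, not of half of it (`laplacian_oddDouble`), because each conjugate pair
of coordinates contributes twice to the divergence of a Hamiltonian field.

The differential needs no separate treatment: the linear field of the doubled differential is the
Hamiltonian field of `D(d)` (`lieD_doubleDifferential`). Thus `d + m` is one odd field of square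
zero, and `½{D(M), D(M)}` vanishes when `M² = 0`, since its momentum coefficients are, up to sign,
the functions `M(M(z))` (`sum_oddDeriv_mul_evenDeriv_oddDouble`). This yields the classical master
equation and the Maurer-Cartan equation on the double.

A unimodular lift `f` then gives the quantum lift `D(m) + 2hf`. The `h`-linear part of its master
equation is twice the unimodularity equation, and nothing survives in higher order because `f`
contains no momenta. From a quantum lift, the coefficient `S₁` is a unimodular lift of the double,
by the `h`-linear part of the master equation. From a unimodular lift `F` of the double, half of its
restriction to the zero section is a unimodular lift of `m`. The factors 2 and ½ both compensate for
`Δ D(m) = ∇m`. -/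

/-- The parity involution of the exterior algebra. -/
abbrev extInv : ExteriorAlgebra k M →ₐ[k] ExteriorAlgebra k M :=
  CliffordAlgebra.involute (Q := (0 : QuadraticForm k M))

/-- The contraction of the exterior algebra with a linear form. -/
abbrev extContr (φ : Module.Dual k M) : ExteriorAlgebra k M →ₗ[k] ExteriorAlgebra k M :=
  CliffordAlgebra.contractLeft (Q := (0 : QuadraticForm k M)) φ

theorem extInv_ι (v : M) : extInv (ExteriorAlgebra.ι k v) = -ExteriorAlgebra.ι k v :=
  CliffordAlgebra.involute_ι v

theorem extContr_ι_mul (φ : Module.Dual k M) (v : M) (g : ExteriorAlgebra k M) :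
    extContr φ (ExteriorAlgebra.ι k v * g)
      = φ v • g - ExteriorAlgebra.ι k v * extContr φ g :=
  CliffordAlgebra.contractLeft_ι_mul (Q := (0 : QuadraticForm k M)) φ v g

theorem extContr_algebraMap (φ : Module.Dual k M) (c : k) :
    extContr φ (algebraMap k (ExteriorAlgebra k M) c) = 0 :=
  CliffordAlgebra.contractLeft_algebraMap (Q := (0 : QuadraticForm k M)) φ c

theorem extContr_one (φ : Module.Dual k M) : extContr φ 1 = 0 :=
  CliffordAlgebra.contractLeft_one (Q := (0 : QuadraticForm k M)) φ

theorem extContr_ι (φ : Module.Dual k M) (v : M) :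
    extContr φ (ExteriorAlgebra.ι k v) = algebraMap k _ (φ v) :=
  CliffordAlgebra.contractLeft_ι (Q := (0 : QuadraticForm k M)) φ v

theorem ext_induction_ι_mul {P : ExteriorAlgebra k M → Prop}
    (h0 : ∀ c : k, P (algebraMap k _ c)) (hadd : ∀ f g, P f → P g → P (f + g))
    (hmul : ∀ v f, P f → P (ExteriorAlgebra.ι k v * f)) (f : ExteriorAlgebra k M) : P f :=
  CliffordAlgebra.left_induction (Q := (0 : QuadraticForm k M)) h0 hadd
    (fun x m hx => hmul m x hx) f

theorem extContr_mul (φ : Module.Dual k M) (f g : ExteriorAlgebra k M) :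
    extContr φ (f * g) = extContr φ f * g + extInv f * extContr φ g := by
  induction f using ext_induction_ι_mul generalizing g with
  | h0 c =>
    rw [extContr_algebraMap, ← Algebra.smul_def, map_smul, AlgHom.commutes, ← Algebra.smul_def,
      zero_mul, zero_add]
  | hadd f f' hf hf' =>
    rw [add_mul, map_add, hf, hf', map_add, map_add, add_mul, add_mul]
    abel
  | hmul v f hf =>
    rw [mul_assoc, extContr_ι_mul, hf, extContr_ι_mul, map_mul, extInv_ι, sub_mul, mul_add,
      smul_mul_assoc, neg_mul, neg_mul, mul_assoc, mul_assoc]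
    abel

theorem extInv_extContr (φ : Module.Dual k M) (f : ExteriorAlgebra k M) :
    extInv (extContr φ f) = -extContr φ (extInv f) := by
  induction f using ext_induction_ι_mul with
  | h0 c => simp only [extContr_algebraMap, AlgHom.commutes, map_zero, neg_zero]
  | hadd f f' hf hf' => simp only [map_add, hf, hf', neg_add]
  | hmul v f hf =>
    simp only [extContr_ι_mul, map_mul, map_sub, map_smul, hf, extInv_ι, neg_mul, map_neg]
    simp

/-- Each vector in a product contributes one sign as `v` moves past it, and the parity involution
records the total. -/
theorem ι_mul_eq_extInv_mul (v : M) (g : ExteriorAlgebra k M) :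
    ExteriorAlgebra.ι k v * g = extInv g * ExteriorAlgebra.ι k v := by
  induction g using ext_induction_ι_mul with
  | h0 c => rw [AlgHom.commutes]; exact (Algebra.commutes c _).symm
  | hadd f f' hf hf' => rw [mul_add, hf, hf', map_add, add_mul]
  | hmul w f hf =>
    rw [← mul_assoc, eq_neg_of_add_eq_zero_left (ExteriorAlgebra.ι_add_mul_swap v w),
      neg_mul, mul_assoc, hf, map_mul, extInv_ι, neg_mul, neg_mul, mul_assoc]

/-- Up to a factor 2, `f + extInv f` and `f - extInv f` are the even and odd parts of `f`. The two
claims are proved together because left multiplication by a vector exchanges the parts. -/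
theorem ext_supercommute (f : ExteriorAlgebra k M) :
    (∀ g, (f + extInv f) * g = g * (f + extInv f)) ∧
      ∀ g, (f - extInv f) * g = extInv g * (f - extInv f) := by
  induction f using ext_induction_ι_mul with
  | h0 c =>
    rw [AlgHom.commutes, sub_self, ← map_add]
    exact ⟨fun g => Algebra.commutes _ _, fun g => by simp⟩
  | hadd f f' hf hf' =>
    constructor
    · intro g
      have h : f + f' + extInv (f + f') = (f + extInv f) + (f' + extInv f') := by
        rw [map_add]; abel
      rw [h, add_mul, hf.1, hf'.1, ← mul_add]
    · intro g
      have h : f + f' - extInv (f + f') = (f - extInv f) + (f' - extInv f') := by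
        rw [map_add]; abel
      rw [h, add_mul, hf.2, hf'.2, ← mul_add]
  | hmul v f hf =>
    constructor
    · intro g
      have h : ExteriorAlgebra.ι k v * f + extInv (ExteriorAlgebra.ι k v * f)
          = ExteriorAlgebra.ι k v * (f - extInv f) := by
        rw [map_mul, extInv_ι, mul_sub, neg_mul, sub_eq_add_neg]
      rw [h, mul_assoc, hf.2, ← mul_assoc, ι_mul_eq_extInv_mul, mul_assoc]
      congr 1
      exact CliffordAlgebra.involute_involute g
    · intro g
      have h : ExteriorAlgebra.ι k v * f - extInv (ExteriorAlgebra.ι k v * f)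
          = ExteriorAlgebra.ι k v * (f + extInv f) := by
        rw [map_mul, extInv_ι, mul_add, neg_mul, sub_neg_eq_add]
      rw [h, mul_assoc, hf.1, ← mul_assoc, ι_mul_eq_extInv_mul, mul_assoc]

theorem extInv_map (L : M →ₗ[k] N) (f : ExteriorAlgebra k M) :
    extInv (ExteriorAlgebra.map L f) = ExteriorAlgebra.map L (extInv f) := by
  induction f using ext_induction_ι_mul with
  | h0 c => simp only [AlgHom.commutes]
  | hadd f f' hf hf' => simp only [map_add, hf, hf']
  | hmul v f hf => simp only [map_mul, hf, extInv_ι, ExteriorAlgebra.map_apply_ι, map_neg]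

theorem extContr_map (L : M →ₗ[k] N) (φ : Module.Dual k N) (f : ExteriorAlgebra k M) :
    extContr φ (ExteriorAlgebra.map L f) = ExteriorAlgebra.map L (extContr (φ ∘ₗ L) f) := by
  induction f using ext_induction_ι_mul with
  | h0 c => simp only [AlgHom.commutes, extContr_algebraMap, map_zero]
  | hadd f f' hf hf' => simp only [map_add, hf, hf']
  | hmul v f hf =>
    simp only [map_mul, hf, extContr_ι_mul, ExteriorAlgebra.map_apply_ι, map_sub, map_smul,
      LinearMap.comp_apply]

/-! ### Exterior powers and the length grading -/

theorem ι_mem_extPower (v : M) : ExteriorAlgebra.ι k v ∈ ⋀[k]^1 M := by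
  rw [ExteriorAlgebra.exteriorPower, pow_one]
  exact LinearMap.mem_range_self _ v

theorem algebraMap_mem_extPower (c : k) : algebraMap k (ExteriorAlgebra k M) c ∈ ⋀[k]^0 M := by
  rw [ExteriorAlgebra.exteriorPower, pow_zero]
  exact Submodule.mem_one.2 ⟨c, rfl⟩

theorem one_mem_extPower : (1 : ExteriorAlgebra k M) ∈ ⋀[k]^0 M := by
  rw [ExteriorAlgebra.exteriorPower, pow_zero]
  exact Submodule.one_le.1 le_rfl

theorem mul_mem_extPower {i j : ℕ} {f g : ExteriorAlgebra k M} (hf : f ∈ ⋀[k]^i M)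
    (hg : g ∈ ⋀[k]^j M) : f * g ∈ ⋀[k]^(i + j) M := by
  rw [ExteriorAlgebra.exteriorPower, pow_add]
  exact Submodule.mul_mem_mul hf hg

theorem extPower_induction {P : ℕ → ExteriorAlgebra k M → Prop}
    (h0 : ∀ c : k, P 0 (algebraMap k _ c)) (hadd : ∀ j f g, P j f → P j g → P j (f + g))
    (hmul : ∀ j v f, f ∈ ⋀[k]^j M → P j f → P (j + 1) (ExteriorAlgebra.ι k v * f))
    {j : ℕ} {f : ExteriorAlgebra k M} (hf : f ∈ ⋀[k]^j M) : P j f := by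
  induction j generalizing f with
  | zero =>
    rw [ExteriorAlgebra.exteriorPower, pow_zero] at hf
    obtain ⟨c, rfl⟩ := Submodule.mem_one.1 hf
    exact h0 c
  | succ j ih =>
    rw [ExteriorAlgebra.exteriorPower, pow_succ'] at hf
    induction hf using Submodule.mul_induction_on' with
    | mem_mul_mem v hv g hg =>
      obtain ⟨v, rfl⟩ := hv
      exact hmul j v g hg (ih hg)
    | add f _ g _ hf hg => exact hadd _ _ _ hf hg

theorem extInv_mem_extPower {j : ℕ} {f : ExteriorAlgebra k M} (hf : f ∈ ⋀[k]^j M) :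
    extInv f ∈ ⋀[k]^j M := by
  refine extPower_induction (P := fun j f => extInv f ∈ ⋀[k]^j M) (fun c => ?_)
    (fun j f g hf hg => ?_) (fun j v f _ hf => ?_) hf
  · rw [AlgHom.commutes]; exact algebraMap_mem_extPower c
  · rw [map_add]; exact Submodule.add_mem _ hf hg
  · rw [map_mul, extInv_ι, neg_mul, add_comm]
    exact Submodule.neg_mem _ (mul_mem_extPower (ι_mem_extPower v) hf)

theorem map_mem_extPower (L : M →ₗ[k] N) {j : ℕ} {f : ExteriorAlgebra k M} (hf : f ∈ ⋀[k]^j M) :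
    ExteriorAlgebra.map L f ∈ ⋀[k]^j N := by
  refine extPower_induction (P := fun j f => ExteriorAlgebra.map L f ∈ ⋀[k]^j N) (fun c => ?_)
    (fun j f g hf hg => ?_) (fun j v f _ hf => ?_) hf
  · rw [AlgHom.commutes]; exact algebraMap_mem_extPower c
  · rw [map_add]; exact Submodule.add_mem _ hf hg
  · rw [map_mul, ExteriorAlgebra.map_apply_ι, add_comm]
    exact mul_mem_extPower (ι_mem_extPower _) hf

theorem extContr_eq_zero_of_mem (φ : Module.Dual k M) {f : ExteriorAlgebra k M}
    (hf : f ∈ ⋀[k]^0 M) : extContr φ f = 0 := by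
  rw [ExteriorAlgebra.exteriorPower, pow_zero] at hf
  obtain ⟨c, rfl⟩ := Submodule.mem_one.1 hf
  exact extContr_algebraMap φ c

theorem extContr_mem_extPower (φ : Module.Dual k M) {j : ℕ} {f : ExteriorAlgebra k M}
    (hf : f ∈ ⋀[k]^(j + 1) M) : extContr φ f ∈ ⋀[k]^j M := by
  refine extPower_induction
    (P := fun i f => ∀ j, i = j + 1 → extContr φ f ∈ ⋀[k]^j M)
    (fun c j hj => by omega) (fun i f g hf hg j hj => ?_) (fun i v f hf ih j hj => ?_) hf j rfl
  · rw [map_add]; exact Submodule.add_mem _ (hf j hj) (hg j hj)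
  · obtain rfl : i = j := by omega
    rw [extContr_ι_mul]
    refine Submodule.sub_mem _ (Submodule.smul_mem _ _ hf) ?_
    cases i with
    | zero => rw [extContr_eq_zero_of_mem φ hf, mul_zero]; exact Submodule.zero_mem _
    | succ i =>
      rw [add_comm]
      exact mul_mem_extPower (ι_mem_extPower v) (ih i rfl)

/-- Reduces statements about `orderGE` to homogeneous exterior coefficients; `s` plays the role of
the degree in the even coordinates. -/
theorem mem_iSup_extPower_induction {n s : ℕ} {P : ExteriorAlgebra k M → Prop} (h0 : P 0)
    (hadd : ∀ f g, P f → P g → P (f + g))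
    (h : ∀ j f, n ≤ s + j → f ∈ ⋀[k]^j M → P f) {f : ExteriorAlgebra k M}
    (hf : f ∈ ⨆ (j : ℕ) (_ : n ≤ s + j), ⋀[k]^j M) : P f := by
  refine Submodule.iSup_induction _ (motive := P) hf (fun j f hf => ?_) h0 hadd
  by_cases hj : n ≤ s + j
  · exact h j f hj (by simpa [hj] using hf)
  · obtain rfl : f = 0 := by simpa [hj] using hf
    exact h0

theorem mem_iSup_extPower {n s j : ℕ} (hj : n ≤ s + j) {f : ExteriorAlgebra k M}
    (hf : f ∈ ⋀[k]^j M) : f ∈ ⨆ (j : ℕ) (_ : n ≤ s + j), ⋀[k]^j M :=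
  Submodule.mem_iSup_of_mem j (Submodule.mem_iSup_of_mem hj hf)

end Exterior

/-! ### Calculus of formal functions -/

section Calculus

variable {k ι κ : Type*} [Field k]

theorem coeff_par (f : FormalFun k ι κ) (a : κ →₀ ℕ) :
    MvPowerSeries.coeff a (par f) = extInv (MvPowerSeries.coeff a f) := rfl

theorem coeff_evenDeriv (j : κ) (f : FormalFun k ι κ) (a : κ →₀ ℕ) :
    MvPowerSeries.coeff a (evenDeriv j f)
      = ((a j : k) + 1) • MvPowerSeries.coeff (a + Finsupp.single j 1) f := rfl

theorem coeff_oddDeriv (i : ι) (f : FormalFun k ι κ) (a : κ →₀ ℕ) :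
    MvPowerSeries.coeff a (oddDeriv i f)
      = extContr (LinearMap.proj i) (MvPowerSeries.coeff a f) := rfl

theorem coeff_ksmul (c : k) (f : FormalFun k ι κ) (a : κ →₀ ℕ) :
    MvPowerSeries.coeff a (c • f) = c • MvPowerSeries.coeff a f := rfl

theorem coeff_evenCoord_mul_add (j : κ) (f : FormalFun k ι κ) (a : κ →₀ ℕ) :
    MvPowerSeries.coeff (a + Finsupp.single j 1) (evenCoord j * f) = MvPowerSeries.coeff a f := by
  rw [add_comm, evenCoord, MvPowerSeries.X_def, MvPowerSeries.coeff_add_monomial_mul, one_mul]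

theorem coeff_evenCoord_mul_of_eq_zero (j : κ) (f : FormalFun k ι κ) {a : κ →₀ ℕ} (ha : a j = 0) :
    MvPowerSeries.coeff a (evenCoord j * f) = 0 := by
  rw [evenCoord, MvPowerSeries.X_def, MvPowerSeries.coeff_monomial_mul, if_neg]
  intro h
  simpa [ha] using h j

theorem par_eq_map (f : FormalFun k ι κ) :
    par f = MvPowerSeries.map (extInv (k := k) (M := ι → k)).toRingHom f := rfl

theorem par_mul (f g : FormalFun k ι κ) : par (f * g) = par f * par g := by
  simp only [par_eq_map, map_mul]

theorem par_one : par (1 : FormalFun k ι κ) = 1 := by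
  simp only [par_eq_map, map_one]

theorem par_par (f : FormalFun k ι κ) : par (par f) = f := by
  refine MvPowerSeries.ext fun a => ?_
  rw [coeff_par, coeff_par]
  exact CliffordAlgebra.involute_involute _

theorem par_evenCoord (j : κ) : par (evenCoord j : FormalFun k ι κ) = evenCoord j := by
  rw [par_eq_map, evenCoord, MvPowerSeries.map_X]

theorem par_oddCoord [DecidableEq ι] (i : ι) :
    par (oddCoord i : FormalFun k ι κ) = -oddCoord i := by
  rw [par_eq_map, oddCoord, MvPowerSeries.map_C, ← map_neg]
  exact congrArg _ (extInv_ι _)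

theorem par_evenDeriv (j : κ) (f : FormalFun k ι κ) :
    par (evenDeriv j f) = evenDeriv j (par f) := by
  refine MvPowerSeries.ext fun a => ?_
  simp only [coeff_par, coeff_evenDeriv, map_smul]

theorem par_oddDeriv (i : ι) (f : FormalFun k ι κ) :
    par (oddDeriv i f) = -oddDeriv i (par f) := by
  refine MvPowerSeries.ext fun a => ?_
  rw [map_neg]
  simp only [coeff_par, coeff_oddDeriv]
  exact extInv_extContr _ _

theorem evenDeriv_comm (i j : κ) (f : FormalFun k ι κ) :
    evenDeriv i (evenDeriv j f) = evenDeriv j (evenDeriv i f) := by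
  classical
  refine MvPowerSeries.ext fun a => ?_
  simp only [coeff_evenDeriv, smul_smul]
  rw [add_right_comm]
  congr 1
  by_cases h : i = j
  · subst h; rfl
  · rw [Finsupp.add_apply, Finsupp.add_apply, Finsupp.single_eq_of_ne h,
      Finsupp.single_eq_of_ne (Ne.symm h)]
    push_cast
    ring

theorem evenDeriv_oddDeriv (i : ι) (j : κ) (f : FormalFun k ι κ) :
    evenDeriv j (oddDeriv i f) = oddDeriv i (evenDeriv j f) := by
  refine MvPowerSeries.ext fun a => ?_
  simp only [coeff_evenDeriv, coeff_oddDeriv, map_smul]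

theorem oddDeriv_comm (i j : ι) (f : FormalFun k ι κ) :
    oddDeriv i (oddDeriv j f) = -oddDeriv j (oddDeriv i f) := by
  refine MvPowerSeries.ext fun a => ?_
  rw [map_neg]
  simp only [coeff_oddDeriv]
  exact CliffordAlgebra.contractLeft_comm _ _ _

theorem oddDeriv_mul (i : ι) (f g : FormalFun k ι κ) :
    oddDeriv i (f * g) = oddDeriv i f * g + par f * oddDeriv i g := by
  classical
  refine MvPowerSeries.ext fun a => ?_
  rw [map_add, coeff_oddDeriv, MvPowerSeries.coeff_mul, MvPowerSeries.coeff_mul,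
    MvPowerSeries.coeff_mul, map_sum, ← Finset.sum_add_distrib]
  exact Finset.sum_congr rfl fun p _ => extContr_mul _ _ _

/-- The Euler operator `x_j ∂_j` is diagonal on monomials, which avoids the index shift in
`evenDeriv`. -/
theorem coeff_evenCoord_mul_evenDeriv (j : κ) (f : FormalFun k ι κ) (a : κ →₀ ℕ) :
    MvPowerSeries.coeff a (evenCoord j * evenDeriv j f) = (a j : k) • MvPowerSeries.coeff a f := by
  by_cases h : a j = 0
  · rw [coeff_evenCoord_mul_of_eq_zero j _ h, h, Nat.cast_zero, zero_smul]
  · obtain ⟨b, rfl⟩ : ∃ b, a = b + Finsupp.single j 1 := by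
      refine ⟨a - Finsupp.single j 1, (tsub_add_cancel_of_le ?_).symm⟩
      rw [Finsupp.single_le_iff]
      omega
    rw [coeff_evenCoord_mul_add, coeff_evenDeriv, Finsupp.add_apply, Finsupp.single_eq_same,
      Nat.cast_add, Nat.cast_one]

theorem evenCoord_mul_cancel (j : κ) {f g : FormalFun k ι κ}
    (h : evenCoord j * f = evenCoord j * g) : f = g := by
  refine MvPowerSeries.ext fun a => ?_
  rw [← coeff_evenCoord_mul_add j, h, coeff_evenCoord_mul_add]

theorem evenCoord_comm (j : κ) (f : FormalFun k ι κ) : evenCoord j * f = f * evenCoord j :=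
  MvPowerSeries.X_mul

theorem evenDeriv_mul (j : κ) (f g : FormalFun k ι κ) :
    evenDeriv j (f * g) = evenDeriv j f * g + f * evenDeriv j g := by
  classical
  -- After multiplication by `x_j` the Leibniz rule concerns the Euler operator, where it is the
  -- additivity of the exponent of `x_j` under products.
  apply evenCoord_mul_cancel j
  rw [mul_add, ← mul_assoc, ← mul_assoc (evenCoord j) f, evenCoord_comm j f, mul_assoc f]
  refine MvPowerSeries.ext fun a => ?_
  rw [map_add, coeff_evenCoord_mul_evenDeriv, MvPowerSeries.coeff_mul, MvPowerSeries.coeff_mul,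
    MvPowerSeries.coeff_mul, Finset.smul_sum, ← Finset.sum_add_distrib]
  refine Finset.sum_congr rfl fun p hp => ?_
  rw [coeff_evenCoord_mul_evenDeriv, coeff_evenCoord_mul_evenDeriv, smul_mul_assoc, mul_smul_comm,
    ← add_smul, ← Finset.HasAntidiagonal.mem_antidiagonal.1 hp, Finsupp.add_apply, Nat.cast_add]

theorem evenDeriv_C (j : κ) (c : ExteriorAlgebra k (ι → k)) :
    evenDeriv j (MvPowerSeries.C c : FormalFun k ι κ) = 0 := by
  refine MvPowerSeries.ext fun a => ?_
  rw [coeff_evenDeriv, MvPowerSeries.coeff_C_of_ne_zero, smul_zero, map_zero]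
  intro h
  simpa using DFunLike.congr_fun h j

theorem evenDeriv_oddCoord [DecidableEq ι] (j : κ) (i : ι) :
    evenDeriv j (oddCoord i : FormalFun k ι κ) = 0 := evenDeriv_C j _

theorem evenDeriv_evenCoord [DecidableEq κ] (j j' : κ) :
    evenDeriv j (evenCoord j' : FormalFun k ι κ) = if j = j' then 1 else 0 := by
  refine MvPowerSeries.ext fun a => ?_
  rw [coeff_evenDeriv, evenCoord, MvPowerSeries.coeff_X]
  by_cases h : j = j'
  · subst h
    rw [if_pos rfl, MvPowerSeries.coeff_one]
    by_cases ha : a = 0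
    · simp [ha]
    · rw [if_neg ha, if_neg, smul_zero]
      simpa using ha
  · rw [if_neg h, if_neg, smul_zero, map_zero]
    intro h'
    have := DFunLike.congr_fun h' j
    rw [Finsupp.add_apply, Finsupp.single_eq_same, Finsupp.single_eq_of_ne h] at this
    omega

theorem oddDeriv_C (i : ι) (c : ExteriorAlgebra k (ι → k)) :
    oddDeriv i (MvPowerSeries.C c : FormalFun k ι κ)
      = MvPowerSeries.C (extContr (LinearMap.proj i) c) := by
  classical
  refine MvPowerSeries.ext fun a => ?_
  rw [coeff_oddDeriv, MvPowerSeries.coeff_C, MvPowerSeries.coeff_C, apply_ite (extContr _),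
    map_zero]

theorem oddDeriv_oddCoord [DecidableEq ι] (i i' : ι) :
    oddDeriv i (oddCoord i' : FormalFun k ι κ) = if i = i' then 1 else 0 := by
  rw [oddCoord, oddDeriv_C, extContr_ι, LinearMap.proj_apply, Pi.single_apply]
  split_ifs <;> simp

theorem oddDeriv_evenCoord (i : ι) (j : κ) :
    oddDeriv i (evenCoord j : FormalFun k ι κ) = 0 := by
  classical
  refine MvPowerSeries.ext fun a => ?_
  rw [coeff_oddDeriv, evenCoord, MvPowerSeries.coeff_X, apply_ite (extContr _), map_zero,
    extContr_one, ite_self, map_zero]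

/-! ### Supercommutativity -/

theorem two_smul_cancel [CharZero k] {E : Type*} [AddCommGroup E] [Module k E] {u v : E}
    (h : u + u = v + v) : u = v := by
  rw [← two_smul k, ← two_smul k] at h
  have h2 : (2 : k) ≠ 0 := two_ne_zero
  simpa [smul_smul, h2] using congrArg ((2 : k)⁻¹ • ·) h

variable [CharZero k]

theorem even_mul_comm {f : FormalFun k ι κ} (hf : par f = f) (g : FormalFun k ι κ) :
    f * g = g * f := by
  classical
  refine MvPowerSeries.ext fun a => ?_
  rw [MvPowerSeries.coeff_mul, MvPowerSeries.coeff_mul,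
    ← Finset.HasAntidiagonal.map_swap_antidiagonal, Finset.sum_map,
    Finset.HasAntidiagonal.map_swap_antidiagonal]
  refine Finset.sum_congr rfl fun p _ => two_smul_cancel (k := k) ?_
  have h : extInv (MvPowerSeries.coeff p.2 f) = MvPowerSeries.coeff p.2 f := by
    rw [← coeff_par, hf]
  have := (ext_supercommute (MvPowerSeries.coeff p.2 f)).1 (MvPowerSeries.coeff p.1 g)
  rwa [h, add_mul, mul_add] at this

theorem odd_mul_comm {f : FormalFun k ι κ} (hf : par f = -f) (g : FormalFun k ι κ) :
    f * g = par g * f := by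
  classical
  refine MvPowerSeries.ext fun a => ?_
  rw [MvPowerSeries.coeff_mul, MvPowerSeries.coeff_mul,
    ← Finset.HasAntidiagonal.map_swap_antidiagonal, Finset.sum_map,
    Finset.HasAntidiagonal.map_swap_antidiagonal]
  refine Finset.sum_congr rfl fun p _ => two_smul_cancel (k := k) ?_
  have h : extInv (MvPowerSeries.coeff p.2 f) = -MvPowerSeries.coeff p.2 f := by
    rw [← coeff_par, hf, map_neg]
  have := (ext_supercommute (MvPowerSeries.coeff p.2 f)).2 (MvPowerSeries.coeff p.1 g)
  rwa [h, sub_neg_eq_add, add_mul, mul_add] at this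

end Calculus

/-! ### Filtration by length -/

section Filtration

variable {k ι κ : Type*} [Field k]

theorem mul_mem_orderGE {m n : ℕ} {f g : FormalFun k ι κ} (hf : f ∈ orderGE m)
    (hg : g ∈ orderGE n) : f * g ∈ orderGE (m + n) := by
  classical
  intro a
  rw [MvPowerSeries.coeff_mul]
  refine Submodule.sum_mem _ fun p hp => ?_
  have hdeg : a.degree = p.1.degree + p.2.degree := by
    rw [← Finset.HasAntidiagonal.mem_antidiagonal.1 hp, map_add]
  refine mem_iSup_extPower_induction
    (P := fun u => u * MvPowerSeries.coeff p.2 g ∈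
      ⨆ (j : ℕ) (_ : m + n ≤ a.degree + j), ⋀[k]^j (ι → k)) ?_ (fun u v hu hv => ?_)
    (fun i u hi hu => ?_) (hf p.1)
  · rw [zero_mul]; exact Submodule.zero_mem _
  · rw [add_mul]; exact Submodule.add_mem _ hu hv
  · refine mem_iSup_extPower_induction
      (P := fun v => u * v ∈
        ⨆ (j : ℕ) (_ : m + n ≤ a.degree + j), ⋀[k]^j (ι → k)) ?_ (fun u v hu hv => ?_)
      (fun j v hj hv => ?_) (hg p.2)
    · rw [mul_zero]; exact Submodule.zero_mem _
    · rw [mul_add]; exact Submodule.add_mem _ hu hv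
    · exact mem_iSup_extPower (by omega) (mul_mem_extPower hu hv)

theorem evenCoord_mem_orderGE (j : κ) : (evenCoord j : FormalFun k ι κ) ∈ orderGE 1 := by
  classical
  intro a
  rw [evenCoord, MvPowerSeries.coeff_X]
  split_ifs with h
  · rw [h]
    exact mem_iSup_extPower (j := 0) (by simp) one_mem_extPower
  · exact Submodule.zero_mem _

theorem oddCoord_mem_orderGE [DecidableEq ι] (i : ι) :
    (oddCoord i : FormalFun k ι κ) ∈ orderGE 1 := by
  classical
  intro a
  rw [oddCoord, MvPowerSeries.coeff_C]
  split_ifs with h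
  · exact mem_iSup_extPower (j := 1) (by omega) (ι_mem_extPower _)
  · exact Submodule.zero_mem _

theorem par_mem_orderGE {n : ℕ} {f : FormalFun k ι κ} (hf : f ∈ orderGE n) :
    par f ∈ orderGE n := by
  intro a
  rw [coeff_par]
  refine mem_iSup_extPower_induction (f := MvPowerSeries.coeff a f)
    (P := fun u => extInv u ∈ ⨆ (j : ℕ) (_ : n ≤ a.degree + j), ⋀[k]^j (ι → k))
    ?_ (fun u v hu hv => ?_) (fun j u hj hu => ?_) (hf a)
  · rw [map_zero]; exact Submodule.zero_mem _
  · rw [map_add]; exact Submodule.add_mem _ hu hv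
  · exact mem_iSup_extPower hj (extInv_mem_extPower hu)

theorem oddDeriv_mem_orderGE {n : ℕ} (i : ι) {f : FormalFun k ι κ} (hf : f ∈ orderGE (n + 1)) :
    oddDeriv i f ∈ orderGE n := by
  intro a
  rw [coeff_oddDeriv]
  refine mem_iSup_extPower_induction (f := MvPowerSeries.coeff a f)
    (P := fun u => extContr (LinearMap.proj i) u ∈
      ⨆ (j : ℕ) (_ : n ≤ a.degree + j), ⋀[k]^j (ι → k))
    ?_ (fun u v hu hv => ?_) (fun j u hj hu => ?_) (hf a)
  · rw [map_zero]; exact Submodule.zero_mem _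
  · rw [map_add]; exact Submodule.add_mem _ hu hv
  · cases j with
    | zero => rw [extContr_eq_zero_of_mem _ hu]; exact Submodule.zero_mem _
    | succ j => exact mem_iSup_extPower (by omega) (extContr_mem_extPower _ hu)

theorem evenDeriv_mem_orderGE {n : ℕ} (i : κ) {f : FormalFun k ι κ} (hf : f ∈ orderGE (n + 1)) :
    evenDeriv i f ∈ orderGE n := by
  intro a
  rw [coeff_evenDeriv]
  refine Submodule.smul_mem _ _ ?_
  refine mem_iSup_extPower_induction
    (P := fun u => u ∈ ⨆ (j : ℕ) (_ : n ≤ a.degree + j), ⋀[k]^j (ι → k))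
    (Submodule.zero_mem _) (fun u v hu hv => Submodule.add_mem _ hu hv)
    (fun j u hj hu => ?_) (hf (a + Finsupp.single i 1))
  rw [map_add, Finsupp.degree_single] at hj
  exact mem_iSup_extPower (by omega) hu

end Filtration

/-! ### Derivations -/

section Derivations

variable {k ι κ : Type*} [Field k]

/-- A Hadamard-type decomposition. It replaces continuity when derivations are shown to be
determined by their values on coordinates. -/
theorem FormalFun.exists_decomposition [CharZero k] [Fintype κ] (f : FormalFun k ι κ) :
    ∃ g : κ → FormalFun k ι κ,
      f = MvPowerSeries.C (MvPowerSeries.coeff 0 f) + ∑ j, evenCoord j * g j := by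
  classical
  -- The coefficient of each nonconstant monomial is shared equally among the even coordinates
  -- dividing it, so no order on `κ` has to be chosen.
  let g : κ → FormalFun k ι κ := fun j a => ((a + Finsupp.single j 1).support.card : k)⁻¹ •
    MvPowerSeries.coeff (a + Finsupp.single j 1) f
  refine ⟨g, MvPowerSeries.ext fun a => ?_⟩
  rw [map_add, map_sum]
  by_cases ha : a = 0
  · subst ha
    rw [MvPowerSeries.coeff_zero_C, Finset.sum_eq_zero, add_zero]
    exact fun j _ => coeff_evenCoord_mul_of_eq_zero j _ rfl
  · rw [MvPowerSeries.coeff_C_of_ne_zero ha, zero_add]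
    have hterm : ∀ j, MvPowerSeries.coeff a (evenCoord j * g j)
        = if j ∈ a.support then (a.support.card : k)⁻¹ • MvPowerSeries.coeff a f else 0 := by
      intro j
      split_ifs with hj
      · rw [Finsupp.mem_support_iff] at hj
        obtain ⟨b, rfl⟩ : ∃ b, a = b + Finsupp.single j 1 := by
          refine ⟨a - Finsupp.single j 1, (tsub_add_cancel_of_le ?_).symm⟩
          rw [Finsupp.single_le_iff]
          omega
        rw [coeff_evenCoord_mul_add]
        rfl
      · exact coeff_evenCoord_mul_of_eq_zero j _ (Finsupp.notMem_support_iff.1 hj)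
    rw [Finset.sum_congr rfl fun j _ => hterm j, Finset.sum_ite_mem, Finset.univ_inter,
      Finset.sum_const, ← Nat.cast_smul_eq_nsmul k, smul_smul, mul_inv_cancel₀, one_smul]
    rw [Nat.cast_ne_zero, Finset.card_ne_zero]
    exact Finsupp.support_nonempty_iff.2 ha

/-- A (twisted) derivation is determined by its values on the coordinate functions. -/
theorem eq_zero_of_twisted_leibniz [CharZero k] [Fintype κ] [Fintype ι] [DecidableEq ι]
    {E : FormalFun k ι κ →ₗ[k] FormalFun k ι κ} {φ : FormalFun k ι κ → FormalFun k ι κ}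
    (h1 : φ 1 = 1) (hX : ∀ j, φ (evenCoord j) = evenCoord j)
    (hE : ∀ f g, E (f * g) = E f * g + φ f * E g)
    (hx : ∀ j, E (evenCoord j) = 0) (hy : ∀ i, E (oddCoord i) = 0) : E = 0 := by
  have hone : E 1 = 0 := by
    have := hE 1 1
    rwa [h1, mul_one, one_mul, mul_one, left_eq_add] at this
  have hC : ∀ c, E (MvPowerSeries.C c) = 0 := by
    intro c
    induction c using ext_induction_ι_mul with
    | h0 c =>
      have : (MvPowerSeries.C (algebraMap k (ExteriorAlgebra k (ι → k)) c) : FormalFun k ι κ)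
          = c • 1 := by
        classical
        refine MvPowerSeries.ext fun a => ?_
        rw [coeff_ksmul, MvPowerSeries.coeff_C, MvPowerSeries.coeff_one, smul_ite, smul_zero,
          Algebra.algebraMap_eq_smul_one]
      rw [this, map_smul, hone, smul_zero]
    | hadd f g hf hg => rw [map_add, map_add, hf, hg, add_zero]
    | hmul v f hf =>
      have : (MvPowerSeries.C (ExteriorAlgebra.ι k v) : FormalFun k ι κ)
          = ∑ i, v i • oddCoord i := by
        classical
        refine MvPowerSeries.ext fun a => ?_
        simp only [map_sum, coeff_ksmul, oddCoord, MvPowerSeries.coeff_C, smul_ite, smul_zero]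
        split_ifs with ha
        · conv_lhs => rw [pi_eq_sum_univ' v]
          simp only [map_sum, map_smul]
        · rw [Finset.sum_const_zero]
      rw [map_mul, hE, hf, mul_zero, add_zero, this, map_sum,
        Finset.sum_eq_zero fun i _ => by rw [map_smul, hy, smul_zero], zero_mul]
  -- Since `E` kills constants and coordinates, the decomposition gives `E f = ∑ x_j E(g_j)`. A
  -- coefficient of `E f` is thus a sum of coefficients of degree one less, of `E` applied to other
  -- functions; hence `f` must vary in the induction.
  have hind : ∀ (n : ℕ) (a : κ →₀ ℕ) (f : FormalFun k ι κ), a.degree = n →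
      MvPowerSeries.coeff a (E f) = 0 := by
    intro n
    induction n with
    | zero =>
      intro a f ha
      obtain ⟨g, hg⟩ := f.exists_decomposition
      rw [hg, map_add, hC, zero_add, map_sum, map_sum]
      refine Finset.sum_eq_zero fun j _ => ?_
      rw [hE, hx, zero_mul, zero_add, hX]
      refine coeff_evenCoord_mul_of_eq_zero j _ ?_
      rw [(Finsupp.degree_eq_zero_iff a).1 ha]
      rfl
    | succ n ih =>
      intro a f ha
      obtain ⟨g, hg⟩ := f.exists_decomposition
      rw [hg, map_add, hC, zero_add, map_sum, map_sum]
      refine Finset.sum_eq_zero fun j _ => ?_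
      rw [hE, hx, zero_mul, zero_add, hX]
      by_cases hj : a j = 0
      · exact coeff_evenCoord_mul_of_eq_zero j _ hj
      · obtain ⟨b, rfl⟩ : ∃ b, a = b + Finsupp.single j 1 := by
          refine ⟨a - Finsupp.single j 1, (tsub_add_cancel_of_le ?_).symm⟩
          rw [Finsupp.single_le_iff]
          omega
        rw [coeff_evenCoord_mul_add]
        apply ih
        rw [map_add, Finsupp.degree_single] at ha
        omega
  exact LinearMap.ext fun f => MvPowerSeries.ext fun a => by
    rw [hind _ a f rfl, LinearMap.zero_apply, map_zero]

theorem vectorField_apply [Fintype ι] [Fintype κ] (c : κ → FormalFun k ι κ)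
    (e : ι → FormalFun k ι κ) (f : FormalFun k ι κ) :
    vectorField c e f = ∑ j, c j * evenDeriv j f + ∑ i, e i * oddDeriv i f := by
  simp [vectorField]

theorem vectorField_evenCoord [Fintype ι] [Fintype κ] (c : κ → FormalFun k ι κ)
    (e : ι → FormalFun k ι κ) (j : κ) : vectorField c e (evenCoord j) = c j := by
  classical
  simp [vectorField_apply, evenDeriv_evenCoord, oddDeriv_evenCoord]

theorem vectorField_oddCoord [Fintype ι] [Fintype κ] [DecidableEq ι] (c : κ → FormalFun k ι κ)
    (e : ι → FormalFun k ι κ) (i : ι) : vectorField c e (oddCoord i) = e i := by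
  simp [vectorField_apply, evenDeriv_oddCoord, oddDeriv_oddCoord]

theorem isOddDerivation_vectorField [CharZero k] [Fintype ι] [Fintype κ]
    {c : κ → FormalFun k ι κ} {e : ι → FormalFun k ι κ} (hc : ∀ j, par (c j) = -c j)
    (he : ∀ i, par (e i) = e i) : IsOddDerivation (vectorField c e) where
  odd f := by
    simp only [vectorField_apply, map_add, map_sum, par_mul, hc, he, par_evenDeriv, par_oddDeriv,
      neg_mul, mul_neg, Finset.sum_neg_distrib, neg_add, neg_neg]
  leibniz f g := by
    simp only [vectorField_apply, evenDeriv_mul, oddDeriv_mul, mul_add, add_mul, Finset.mul_sum,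
      Finset.sum_mul, Finset.sum_add_distrib]
    have h1 : ∀ j, c j * (f * evenDeriv j g) = par f * (c j * evenDeriv j g) := fun j => by
      rw [← mul_assoc, odd_mul_comm (hc j), mul_assoc]
    have h2 : ∀ i, e i * (par f * oddDeriv i g) = par f * (e i * oddDeriv i g) := fun i => by
      rw [← mul_assoc, even_mul_comm (he i), mul_assoc]
    simp only [h1, h2, ← mul_assoc]
    abel

namespace IsOddDerivation

variable {m : FormalFun k ι κ →ₗ[k] FormalFun k ι κ}

theorem par_evenCoord (hm : IsOddDerivation m) (j : κ) :
    par (m (evenCoord j)) = -m (evenCoord j) := by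
  rw [eq_neg_iff_add_eq_zero, ← neg_eq_iff_add_eq_zero, ← hm.odd, LInf.par_evenCoord]

theorem par_oddCoord [DecidableEq ι] (hm : IsOddDerivation m) (i : ι) :
    par (m (oddCoord i)) = m (oddCoord i) := by
  rw [← neg_inj, ← hm.odd, LInf.par_oddCoord, map_neg]

theorem add {m' : FormalFun k ι κ →ₗ[k] FormalFun k ι κ} (hm : IsOddDerivation m)
    (hm' : IsOddDerivation m') : IsOddDerivation (m + m') where
  odd f := by
    simp only [LinearMap.add_apply, hm.odd, hm'.odd, map_add, neg_add]
  leibniz f g := by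
    simp only [LinearMap.add_apply, hm.leibniz, hm'.leibniz, add_mul, mul_add]
    abel

theorem eq_vectorField [CharZero k] [Fintype ι] [Fintype κ] [DecidableEq ι]
    (hm : IsOddDerivation m) :
    m = vectorField (fun j => m (evenCoord j)) (fun i => m (oddCoord i)) := by
  rw [← sub_eq_zero]
  have hv := isOddDerivation_vectorField hm.par_evenCoord hm.par_oddCoord
  refine eq_zero_of_twisted_leibniz (φ := par) par_one LInf.par_evenCoord (fun f g => ?_)
    (fun j => ?_) (fun i => ?_)
  · simp only [LinearMap.sub_apply, hm.leibniz, hv.leibniz, sub_mul, mul_sub]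
    abel
  · rw [LinearMap.sub_apply, vectorField_evenCoord, sub_self]
  · rw [LinearMap.sub_apply, vectorField_oddCoord, sub_self]

theorem apply_eq [CharZero k] [Fintype ι] [Fintype κ] [DecidableEq ι]
    (hm : IsOddDerivation m) (f : FormalFun k ι κ) :
    m f = ∑ j, m (evenCoord j) * evenDeriv j f + ∑ i, m (oddCoord i) * oddDeriv i f := by
  conv_lhs => rw [hm.eq_vectorField]
  rw [vectorField_apply]

/-- The square of an odd derivation is an ordinary derivation: the cross terms cancel because `m`
anticommutes with `par`. It therefore suffices to test coordinates, with trivial twist. -/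
theorem comp_self_eq_zero [CharZero k] [Fintype ι] [Fintype κ] [DecidableEq ι]
    (hm : IsOddDerivation m) (hx : ∀ j, m (m (evenCoord j)) = 0)
    (hy : ∀ i, m (m (oddCoord i)) = 0) : m ∘ₗ m = 0 := by
  refine eq_zero_of_twisted_leibniz (φ := id) rfl (fun _ => rfl) (fun f g => ?_) hx hy
  simp only [LinearMap.comp_apply, hm.leibniz, map_add, par_par, hm.odd, id_eq]
  noncomm_ring

end IsOddDerivation

theorem lieD_evenCoord {V₀ V₁ : Type*} [AddCommGroup V₀] [Module k V₀] [AddCommGroup V₁]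
    [Module k V₁] [Fintype ι] [Fintype κ] [DecidableEq ι] (d : Differential k V₀ V₁)
    (b₀ : Module.Basis ι k V₀) (b₁ : Module.Basis κ k V₁) (j : κ) :
    lieD d b₀ b₁ (evenCoord j) = ∑ i, b₁.coord j (d.d₀ (b₀ i)) • oddCoord i :=
  vectorField_evenCoord _ _ j

theorem lieD_oddCoord {V₀ V₁ : Type*} [AddCommGroup V₀] [Module k V₀] [AddCommGroup V₁]
    [Module k V₁] [Fintype ι] [Fintype κ] [DecidableEq ι] (d : Differential k V₀ V₁)
    (b₀ : Module.Basis ι k V₀) (b₁ : Module.Basis κ k V₁) (i : ι) :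
    lieD d b₀ b₁ (oddCoord i) = ∑ j, b₀.coord i (d.d₁ (b₁ j)) • evenCoord j :=
  vectorField_oddCoord _ _ i

theorem isOddDerivation_lieD {V₀ V₁ : Type*} [CharZero k] [AddCommGroup V₀] [Module k V₀]
    [AddCommGroup V₁] [Module k V₁] [Fintype ι] [Fintype κ] [DecidableEq ι]
    (d : Differential k V₀ V₁) (b₀ : Module.Basis ι k V₀) (b₁ : Module.Basis κ k V₁) :
    IsOddDerivation (lieD d b₀ b₁) := by
  refine isOddDerivation_vectorField (fun j => ?_) (fun i => ?_)
  · simp only [map_sum, map_smul, par_oddCoord, smul_neg, Finset.sum_neg_distrib]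
  · simp only [map_sum, map_smul, par_evenCoord]

theorem sum_coord_mul_coord {V V' ι' : Type*} [AddCommGroup V] [Module k V] [AddCommGroup V']
    [Module k V'] [Fintype ι] (b : Module.Basis ι k V) (b' : Module.Basis ι' k V')
    (L : V →ₗ[k] V') (v : V) (i' : ι') :
    ∑ i, b'.coord i' (L (b i)) * b.coord i v = b'.coord i' (L v) := by
  conv_rhs => rw [← b.sum_repr v]
  simp only [map_sum, map_smul, smul_eq_mul, Module.Basis.coord_apply]
  exact Finset.sum_congr rfl fun i _ => mul_comm _ _

theorem lieD_comp_lieD {V₀ V₁ : Type*} [CharZero k] [AddCommGroup V₀] [Module k V₀]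
    [AddCommGroup V₁] [Module k V₁] [Fintype ι] [Fintype κ] [DecidableEq ι]
    (d : Differential k V₀ V₁) (b₀ : Module.Basis ι k V₀) (b₁ : Module.Basis κ k V₁) :
    lieD d b₀ b₁ ∘ₗ lieD d b₀ b₁ = 0 := by
  refine (isOddDerivation_lieD d b₀ b₁).comp_self_eq_zero (fun j => ?_) (fun i => ?_)
  · rw [lieD_evenCoord, map_sum]
    simp only [map_smul, lieD_oddCoord, Finset.smul_sum, smul_smul]
    rw [Finset.sum_comm]
    -- The coefficients are the matrix entries of the composite of the two halves of the
    -- differential.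
    simp only [← Finset.sum_smul, sum_coord_mul_coord b₀ b₁ d.d₀, d.d₀_d₁, map_zero, zero_smul,
      Finset.sum_const_zero]
  · rw [lieD_oddCoord, map_sum]
    simp only [map_smul, lieD_evenCoord, Finset.smul_sum, smul_smul]
    rw [Finset.sum_comm]
    simp only [← Finset.sum_smul, sum_coord_mul_coord b₁ b₀ d.d₁, d.d₁_d₀, map_zero, zero_smul,
      Finset.sum_const_zero]

end Derivations

/-! ### The zero section of the odd double -/

section ZeroSection

variable {k ι κ : Type*} [Field k]

/-- Exponents in the even coordinates on `ΠV`, as exponents on the odd double. -/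
def inclExp (b : κ →₀ ℕ) : (ι ⊕ κ) →₀ ℕ := b.mapDomain Sum.inr

theorem inclExp_inr (b : κ →₀ ℕ) (j : κ) : (inclExp b : (ι ⊕ κ) →₀ ℕ) (Sum.inr j) = b j :=
  Finsupp.mapDomain_apply Sum.inr_injective _ _

theorem inclExp_inl (b : κ →₀ ℕ) (i : ι) : (inclExp b : (ι ⊕ κ) →₀ ℕ) (Sum.inl i) = 0 :=
  Finsupp.mapDomain_of_notMem_range _ _ (by simp)

theorem inclExp_add (b c : κ →₀ ℕ) :
    (inclExp (b + c) : (ι ⊕ κ) →₀ ℕ) = inclExp b + inclExp c := Finsupp.mapDomain_add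

theorem inclExp_single (j : κ) :
    (inclExp (Finsupp.single j 1) : (ι ⊕ κ) →₀ ℕ) = Finsupp.single (Sum.inr j) 1 :=
  Finsupp.mapDomain_single

theorem inclExp_injective : Function.Injective (inclExp : (κ →₀ ℕ) → (ι ⊕ κ) →₀ ℕ) :=
  Finsupp.mapDomain_injective Sum.inr_injective

theorem degree_inclExp (b : κ →₀ ℕ) : (inclExp b : (ι ⊕ κ) →₀ ℕ).degree = b.degree :=
  Finsupp.degree_mapDomain _ _

theorem comapDomain_inclExp (b : κ →₀ ℕ) :
    (inclExp b : (ι ⊕ κ) →₀ ℕ).comapDomain Sum.inr Sum.inr_injective.injOn = b :=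
  Finsupp.ext fun j => by rw [Finsupp.comapDomain_apply, inclExp_inr]

theorem eq_inclExp {a : (ι ⊕ κ) →₀ ℕ} (h : ∀ i, a (Sum.inl i) = 0) :
    a = inclExp (a.comapDomain Sum.inr Sum.inr_injective.injOn) := by
  refine Finsupp.ext fun s => ?_
  rcases s with i | j
  · rw [h, inclExp_inl]
  · rw [inclExp_inr, Finsupp.comapDomain_apply]

theorem inclExp_or (a : (ι ⊕ κ) →₀ ℕ) :
    (∃ b : κ →₀ ℕ, a = inclExp b) ∨ ∃ i, a (Sum.inl i) ≠ 0 := by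
  by_cases h : ∀ i, a (Sum.inl i) = 0
  · exact Or.inl ⟨_, eq_inclExp h⟩
  · exact Or.inr (not_forall.1 h)

/-- If an exponent has no even momenta, neither summand of any splitting has. This is what makes
both `inclL` and `restrict` multiplicative. -/
theorem sum_antidiagonal_inclExp [DecidableEq ι] [DecidableEq κ] {E : Type*} [AddCommMonoid E]
    (F : ((ι ⊕ κ) →₀ ℕ) → ((ι ⊕ κ) →₀ ℕ) → E) (b : κ →₀ ℕ) :
    ∑ p ∈ Finset.HasAntidiagonal.antidiagonal (inclExp b), F p.1 p.2
      = ∑ p ∈ Finset.HasAntidiagonal.antidiagonal b, F (inclExp p.1) (inclExp p.2) := by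
  symm
  refine Finset.sum_bij (fun p _ => (inclExp p.1, inclExp p.2)) (fun p hp => ?_)
    (fun p _ q _ h => ?_) (fun p hp => ?_) (fun _ _ => rfl)
  · rw [Finset.HasAntidiagonal.mem_antidiagonal] at hp ⊢
    rw [← hp, inclExp_add]
  · rw [Prod.mk.injEq] at h
    exact Prod.ext (inclExp_injective h.1) (inclExp_injective h.2)
  · rw [Finset.HasAntidiagonal.mem_antidiagonal] at hp
    have h (i : ι) : p.1 (Sum.inl i) + p.2 (Sum.inl i) = 0 := by
      rw [← Finsupp.add_apply, hp, inclExp_inl]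
    have h1 := eq_inclExp (a := p.1) fun i => by have := h i; omega
    have h2 := eq_inclExp (a := p.2) fun i => by have := h i; omega
    refine ⟨(_, _), ?_, Prod.ext h1.symm h2.symm⟩
    rw [Finset.HasAntidiagonal.mem_antidiagonal]
    apply inclExp_injective (ι := ι)
    rw [inclExp_add, ← hp]
    exact (congrArg₂ (· + ·) h1 h2).symm

/-- The extension by zero of the odd linear coordinates. -/
abbrev inclLin : (ι → k) →ₗ[k] (ι ⊕ κ → k) :=
  LinearMap.pi (Sum.elim (fun i => LinearMap.proj i) fun _ => 0)

theorem proj_inl_comp_inclLin (i : ι) :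
    (LinearMap.proj (Sum.inl i) : (ι ⊕ κ → k) →ₗ[k] k) ∘ₗ inclLin = LinearMap.proj i := rfl

theorem proj_inr_comp_inclLin (j : κ) :
    (LinearMap.proj (Sum.inr j) : (ι ⊕ κ → k) →ₗ[k] k) ∘ₗ inclLin = 0 := rfl

/-- The standard test for identities between pulled-back functions, which have no monomials
containing even momenta. -/
theorem eq_of_coeff_inclExp {F G : FormalFun k (ι ⊕ κ) (ι ⊕ κ)}
    (h : ∀ b, MvPowerSeries.coeff (inclExp b) F = MvPowerSeries.coeff (inclExp b) G)
    (hF : ∀ a i, a (Sum.inl i) ≠ 0 → MvPowerSeries.coeff a F = 0)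
    (hG : ∀ a i, a (Sum.inl i) ≠ 0 → MvPowerSeries.coeff a G = 0) : F = G := by
  refine MvPowerSeries.ext fun a => ?_
  rcases inclExp_or a with ⟨b, rfl⟩ | ⟨i, hi⟩
  · exact h b
  · rw [hF a i hi, hG a i hi]

variable [Fintype ι]

theorem coeff_incl_inclExp (f : FormalFun k ι κ) (b : κ →₀ ℕ) :
    MvPowerSeries.coeff (inclExp b) (incl f)
      = ExteriorAlgebra.map inclLin (MvPowerSeries.coeff b f) := by
  refine (if_pos fun i => inclExp_inl b i).trans ?_
  rw [comapDomain_inclExp]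

theorem coeff_incl_of_ne_zero (f : FormalFun k ι κ) {a : (ι ⊕ κ) →₀ ℕ} {i : ι}
    (h : a (Sum.inl i) ≠ 0) : MvPowerSeries.coeff a (incl f) = 0 :=
  if_neg fun h' => h (h' i)

/-- The inclusion of the functions on `ΠV`, as a linear map. -/
def inclL : FormalFun k ι κ →ₗ[k] FormalFun k (ι ⊕ κ) (ι ⊕ κ) where
  toFun := incl
  map_add' f g := by
    refine eq_of_coeff_inclExp (fun b => ?_) (fun a i h => coeff_incl_of_ne_zero _ h)
      (fun a i h => ?_)
    · simp only [coeff_incl_inclExp, map_add]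
    · rw [map_add, coeff_incl_of_ne_zero _ h, coeff_incl_of_ne_zero _ h, add_zero]
  map_smul' c f := by
    refine eq_of_coeff_inclExp (fun b => ?_) (fun a i h => coeff_incl_of_ne_zero _ h)
      (fun a i h => ?_)
    · simp only [coeff_incl_inclExp, coeff_ksmul, map_smul, RingHom.id_apply]
    · rw [coeff_ksmul, coeff_incl_of_ne_zero _ h, smul_zero]

theorem inclL_apply (f : FormalFun k ι κ) : inclL f = incl f := rfl

theorem coeff_inclL_inclExp (f : FormalFun k ι κ) (b : κ →₀ ℕ) :
    MvPowerSeries.coeff (inclExp b) (inclL f)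
      = ExteriorAlgebra.map inclLin (MvPowerSeries.coeff b f) := coeff_incl_inclExp f b

theorem coeff_inclL_of_ne_zero (f : FormalFun k ι κ) {a : (ι ⊕ κ) →₀ ℕ} {i : ι}
    (h : a (Sum.inl i) ≠ 0) : MvPowerSeries.coeff a (inclL f) = 0 := coeff_incl_of_ne_zero f h

theorem inclL_mul (f g : FormalFun k ι κ) : inclL (f * g) = inclL f * inclL g := by
  classical
  refine eq_of_coeff_inclExp (fun b => ?_) (fun a i h => coeff_inclL_of_ne_zero _ h)
    (fun a i h => ?_)
  · rw [coeff_inclL_inclExp, MvPowerSeries.coeff_mul, MvPowerSeries.coeff_mul,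
      sum_antidiagonal_inclExp fun p q => MvPowerSeries.coeff p (inclL f) *
        MvPowerSeries.coeff q (inclL g), map_sum]
    exact Finset.sum_congr rfl fun p _ => by
      rw [map_mul, coeff_inclL_inclExp, coeff_inclL_inclExp]
  · rw [MvPowerSeries.coeff_mul]
    refine Finset.sum_eq_zero fun p hp => ?_
    rw [← Finset.HasAntidiagonal.mem_antidiagonal.1 hp, Finsupp.add_apply] at h
    by_cases h1 : p.1 (Sum.inl i) = 0
    · rw [h1, zero_add] at h
      rw [coeff_inclL_of_ne_zero g h, mul_zero]
    · rw [coeff_inclL_of_ne_zero f h1, zero_mul]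

theorem par_inclL (f : FormalFun k ι κ) : par (inclL f) = inclL (par f) := by
  refine eq_of_coeff_inclExp (fun b => ?_) (fun a i h => ?_)
    (fun a i h => coeff_inclL_of_ne_zero _ h)
  · rw [coeff_par, coeff_inclL_inclExp, coeff_inclL_inclExp, extInv_map, coeff_par]
  · rw [coeff_par, coeff_inclL_of_ne_zero _ h, map_zero]

theorem evenDeriv_inr_inclL (j : κ) (f : FormalFun k ι κ) :
    evenDeriv (Sum.inr j) (inclL f) = inclL (evenDeriv j f) := by
  refine eq_of_coeff_inclExp (fun b => ?_) (fun a i h => ?_)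
    (fun a i h => coeff_inclL_of_ne_zero _ h)
  · rw [coeff_evenDeriv, inclExp_inr, ← inclExp_single, ← inclExp_add, coeff_inclL_inclExp,
      coeff_inclL_inclExp, coeff_evenDeriv, map_smul]
  · rw [coeff_evenDeriv, coeff_inclL_of_ne_zero (i := i) f, smul_zero]
    rw [Finsupp.add_apply]
    omega

theorem evenDeriv_inl_inclL (i : ι) (f : FormalFun k ι κ) :
    evenDeriv (Sum.inl i) (inclL f) = 0 := by
  refine MvPowerSeries.ext fun a => ?_
  rw [coeff_evenDeriv, coeff_inclL_of_ne_zero (i := i) f, smul_zero, map_zero]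
  rw [Finsupp.add_apply, Finsupp.single_eq_same]
  omega

theorem oddDeriv_inl_inclL (i : ι) (f : FormalFun k ι κ) :
    oddDeriv (Sum.inl i) (inclL f) = inclL (oddDeriv i f) := by
  refine eq_of_coeff_inclExp (fun b => ?_) (fun a i h => ?_)
    (fun a i h => coeff_inclL_of_ne_zero _ h)
  · rw [coeff_oddDeriv, coeff_inclL_inclExp, coeff_inclL_inclExp, extContr_map,
      proj_inl_comp_inclLin, coeff_oddDeriv]
  · rw [coeff_oddDeriv, coeff_inclL_of_ne_zero _ h, map_zero]

theorem oddDeriv_inr_inclL (j : κ) (f : FormalFun k ι κ) :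
    oddDeriv (Sum.inr j) (inclL f) = 0 := by
  refine eq_of_coeff_inclExp (fun b => ?_) (fun a i h => ?_) (fun a i h => map_zero _)
  · rw [coeff_oddDeriv, coeff_inclL_inclExp, extContr_map, proj_inr_comp_inclLin,
      extContr, map_zero, LinearMap.zero_apply, map_zero, map_zero]
  · rw [coeff_oddDeriv, coeff_inclL_of_ne_zero _ h, map_zero]

theorem inclL_one : inclL (1 : FormalFun k ι κ) = 1 := by
  classical
  have h0 : (inclExp 0 : (ι ⊕ κ) →₀ ℕ) = 0 := Finsupp.mapDomain_zero
  refine eq_of_coeff_inclExp (fun b => ?_) (fun a i h => coeff_inclL_of_ne_zero _ h)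
    (fun a i h => ?_)
  · rw [coeff_inclL_inclExp, MvPowerSeries.coeff_one, MvPowerSeries.coeff_one, ← h0]
    simp only [inclExp_injective.eq_iff, apply_ite (ExteriorAlgebra.map _), map_one, map_zero]
  · rw [MvPowerSeries.coeff_one, if_neg]
    rintro rfl
    simp at h

theorem inclL_evenCoord (j : κ) :
    inclL (evenCoord j : FormalFun k ι κ) = evenCoord (Sum.inr j) := by
  classical
  refine eq_of_coeff_inclExp (fun b => ?_) (fun a i h => coeff_inclL_of_ne_zero _ h)
    (fun a i h => ?_)
  · rw [coeff_inclL_inclExp, evenCoord, evenCoord, MvPowerSeries.coeff_X, MvPowerSeries.coeff_X,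
      ← inclExp_single]
    simp only [inclExp_injective.eq_iff, apply_ite (ExteriorAlgebra.map _), map_one, map_zero]
  · rw [evenCoord, MvPowerSeries.coeff_X, if_neg]
    rintro rfl
    simp at h

theorem inclL_oddCoord [DecidableEq ι] [DecidableEq κ] (i : ι) :
    inclL (oddCoord i : FormalFun k ι κ) = oddCoord (Sum.inl i) := by
  have h0 : (inclExp 0 : (ι ⊕ κ) →₀ ℕ) = 0 := Finsupp.mapDomain_zero
  refine eq_of_coeff_inclExp (fun b => ?_) (fun a i h => coeff_inclL_of_ne_zero _ h)
    (fun a i h => ?_)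
  · rw [coeff_inclL_inclExp, oddCoord, oddCoord, MvPowerSeries.coeff_C, MvPowerSeries.coeff_C,
      ← h0]
    simp only [inclExp_injective.eq_iff, apply_ite (ExteriorAlgebra.map _), map_zero,
      ExteriorAlgebra.map_apply_ι]
    congr 2
    funext s
    rcases s with i' | j <;> simp [Pi.single_apply]
  · rw [oddCoord, MvPowerSeries.coeff_C, if_neg]
    rintro rfl
    simp at h

theorem inclL_mem_orderGE {n : ℕ} {f : FormalFun k ι κ} (hf : f ∈ orderGE n) :
    inclL f ∈ orderGE n := by
  intro a
  rcases inclExp_or a with ⟨b, rfl⟩ | ⟨i, hi⟩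
  · rw [coeff_inclL_inclExp, degree_inclExp]
    refine mem_iSup_extPower_induction (f := MvPowerSeries.coeff b f)
      (P := fun u => ExteriorAlgebra.map inclLin u ∈
        ⨆ (j : ℕ) (_ : n ≤ b.degree + j), ⋀[k]^j (ι ⊕ κ → k))
      ?_ (fun u v hu hv => ?_) (fun j u hj hu => ?_) (hf b)
    · rw [map_zero]; exact Submodule.zero_mem _
    · rw [map_add]; exact Submodule.add_mem _ hu hv
    · exact mem_iSup_extPower hj (map_mem_extPower _ hu)
  · rw [coeff_inclL_of_ne_zero f hi]
    exact Submodule.zero_mem _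

end ZeroSection

/-! ### Restriction to the zero section -/

section Restriction

variable {k ι κ : Type*} [Field k]

/-- The restriction of the odd linear coordinates to the zero section. -/
abbrev restrictLin : (ι ⊕ κ → k) →ₗ[k] (ι → k) := LinearMap.funLeft k k Sum.inl

/-- The underlying function of `restrict`. -/
def restrictFun (F : FormalFun k (ι ⊕ κ) (ι ⊕ κ)) : FormalFun k ι κ :=
  fun b => ExteriorAlgebra.map restrictLin (MvPowerSeries.coeff (inclExp b) F)

theorem coeff_restrictFun (F : FormalFun k (ι ⊕ κ) (ι ⊕ κ)) (b : κ →₀ ℕ) :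
    MvPowerSeries.coeff b (restrictFun F)
      = ExteriorAlgebra.map restrictLin (MvPowerSeries.coeff (inclExp b) F) := rfl

/-- The restriction of functions on the odd double to the zero section `ΠV`. -/
def restrict : FormalFun k (ι ⊕ κ) (ι ⊕ κ) →ₗ[k] FormalFun k ι κ where
  toFun := restrictFun
  map_add' F G := MvPowerSeries.ext fun b => by
    simp only [coeff_restrictFun, map_add]
  map_smul' c F := MvPowerSeries.ext fun b => by
    simp only [coeff_restrictFun, coeff_ksmul, map_smul, RingHom.id_apply]

theorem coeff_restrict (F : FormalFun k (ι ⊕ κ) (ι ⊕ κ)) (b : κ →₀ ℕ) :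
    MvPowerSeries.coeff b (restrict F)
      = ExteriorAlgebra.map restrictLin (MvPowerSeries.coeff (inclExp b) F) := rfl

theorem restrict_inclL [Fintype ι] (f : FormalFun k ι κ) : restrict (inclL f) = f := by
  refine MvPowerSeries.ext fun b => ?_
  have h : (restrictLin : (ι ⊕ κ → k) →ₗ[k] (ι → k)) ∘ₗ inclLin = LinearMap.id := rfl
  rw [coeff_restrict, coeff_inclL_inclExp, ← AlgHom.comp_apply, ExteriorAlgebra.map_comp_map, h,
    ExteriorAlgebra.map_id, AlgHom.id_apply]

theorem restrict_mul (F G : FormalFun k (ι ⊕ κ) (ι ⊕ κ)) :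
    restrict (F * G) = restrict F * restrict G := by
  classical
  refine MvPowerSeries.ext fun b => ?_
  rw [coeff_restrict, MvPowerSeries.coeff_mul, MvPowerSeries.coeff_mul,
    sum_antidiagonal_inclExp fun p q => MvPowerSeries.coeff p F * MvPowerSeries.coeff q G, map_sum]
  exact Finset.sum_congr rfl fun p _ => map_mul _ _ _

theorem restrict_par (F : FormalFun k (ι ⊕ κ) (ι ⊕ κ)) : restrict (par F) = par (restrict F) := by
  refine MvPowerSeries.ext fun b => ?_
  rw [coeff_par, coeff_restrict, coeff_restrict, extInv_map, coeff_par]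

theorem restrict_evenDeriv_inr (j : κ) (F : FormalFun k (ι ⊕ κ) (ι ⊕ κ)) :
    restrict (evenDeriv (Sum.inr j) F) = evenDeriv j (restrict F) := by
  refine MvPowerSeries.ext fun b => ?_
  rw [coeff_restrict, coeff_evenDeriv, coeff_evenDeriv, coeff_restrict, inclExp_inr,
    ← inclExp_single, ← inclExp_add, map_smul]

theorem restrict_oddDeriv_inl (i : ι) (F : FormalFun k (ι ⊕ κ) (ι ⊕ κ)) :
    restrict (oddDeriv (Sum.inl i) F) = oddDeriv i (restrict F) := by
  refine MvPowerSeries.ext fun b => ?_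
  rw [coeff_restrict, coeff_oddDeriv, coeff_oddDeriv, coeff_restrict, extContr_map]
  rfl

theorem restrict_evenCoord_inl (i : ι) :
    restrict (evenCoord (Sum.inl i) : FormalFun k (ι ⊕ κ) (ι ⊕ κ)) = 0 := by
  classical
  refine MvPowerSeries.ext fun b => ?_
  rw [coeff_restrict, evenCoord, MvPowerSeries.coeff_X, if_neg, map_zero, map_zero]
  intro h
  have := DFunLike.congr_fun h (Sum.inl i)
  rw [inclExp_inl, Finsupp.single_eq_same] at this
  omega

theorem restrict_oddCoord_inr [DecidableEq ι] [DecidableEq κ] (j : κ) :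
    restrict (oddCoord (Sum.inr j) : FormalFun k (ι ⊕ κ) (ι ⊕ κ)) = 0 := by
  refine MvPowerSeries.ext fun b => ?_
  have h : restrictLin (Pi.single (Sum.inr j) 1 : ι ⊕ κ → k) = 0 := by
    funext i
    simp [LinearMap.funLeft_apply]
  rw [coeff_restrict, oddCoord, MvPowerSeries.coeff_C, apply_ite (ExteriorAlgebra.map _),
    ExteriorAlgebra.map_apply_ι, h, map_zero, map_zero, ite_self, map_zero]

theorem restrict_mem_orderGE {n : ℕ} {F : FormalFun k (ι ⊕ κ) (ι ⊕ κ)} (hF : F ∈ orderGE n) :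
    restrict F ∈ orderGE n := by
  intro b
  rw [coeff_restrict]
  have h := hF (inclExp b)
  rw [degree_inclExp] at h
  refine mem_iSup_extPower_induction (f := MvPowerSeries.coeff (inclExp b) F)
    (P := fun u => ExteriorAlgebra.map restrictLin u ∈
      ⨆ (j : ℕ) (_ : n ≤ b.degree + j), ⋀[k]^j (ι → k))
    ?_ (fun u v hu hv => ?_) (fun j u hj hu => ?_) h
  · rw [map_zero]; exact Submodule.zero_mem _
  · rw [map_add]; exact Submodule.add_mem _ hu hv
  · exact mem_iSup_extPower hj (map_mem_extPower _ hu)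

end Restriction

/-! ### Hamiltonian vector fields -/

theorem par_oddDeriv_of_even {k ι κ : Type*} [Field k] {f : FormalFun k ι κ} (hf : par f = f) (a : ι) :
    par (oddDeriv a f) = -oddDeriv a f := by rw [par_oddDeriv, hf]

theorem par_evenDeriv_of_even {k ι κ : Type*} [Field k] {f : FormalFun k ι κ} (hf : par f = f) (a : κ) :
    par (evenDeriv a f) = evenDeriv a f := by rw [par_evenDeriv, hf]

section Hamiltonian

variable {k τ : Type*} [Field k] [Fintype τ]

theorem hamiltonian_apply {f : FormalFun k τ τ} (hf : par f = f) (g : FormalFun k τ τ) :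
    hamiltonian f g
      = ∑ a, oddDeriv a f * evenDeriv a g + ∑ a, evenDeriv a f * oddDeriv a g := by
  rw [hamiltonian, vectorField_apply, hf]

theorem hamiltonian_add (f g : FormalFun k τ τ) :
    hamiltonian (f + g) = hamiltonian f + hamiltonian g := by
  refine LinearMap.ext fun u => ?_
  simp only [hamiltonian, vectorField_apply, LinearMap.add_apply, map_add, add_mul,
    Finset.sum_add_distrib]
  abel

theorem hamiltonian_zero : hamiltonian (0 : FormalFun k τ τ) = 0 := by
  refine LinearMap.ext fun u => ?_
  simp [hamiltonian, vectorField_apply]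

theorem antibracket_zero_left (g : FormalFun k τ τ) : antibracket 0 g = 0 := by
  rw [antibracket, hamiltonian_zero, LinearMap.zero_apply]

theorem antibracket_zero_right (f : FormalFun k τ τ) : antibracket f 0 = 0 := map_zero _

theorem hamiltonian_evenCoord (f : FormalFun k τ τ) (a : τ) :
    hamiltonian f (evenCoord a) = oddDeriv a f := vectorField_evenCoord _ _ a

theorem hamiltonian_oddCoord [DecidableEq τ] {f : FormalFun k τ τ} (hf : par f = f) (a : τ) :
    hamiltonian f (oddCoord a) = evenDeriv a f :=
  (vectorField_oddCoord _ _ a).trans (congrArg _ hf)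

/-- Both coordinates of a conjugate pair contribute the same mixed second derivative; the ½ in
`laplacian` removes this doubling. -/
theorem divergence_hamiltonian [DecidableEq τ] {f : FormalFun k τ τ} (hf : par f = f) :
    divergence (hamiltonian f) = (2 : k) • ∑ a, oddDeriv a (evenDeriv a f) := by
  simp only [divergence, hamiltonian_evenCoord, hamiltonian_oddCoord hf,
    par_evenDeriv_of_even hf, evenDeriv_oddDeriv, two_smul]

variable [CharZero k]

theorem isOddDerivation_hamiltonian {f : FormalFun k τ τ} (hf : par f = f) :
    IsOddDerivation (hamiltonian f) :=
  isOddDerivation_vectorField (fun a => par_oddDeriv_of_even hf a)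
    (fun a => by rw [hf, par_evenDeriv_of_even hf])

theorem laplacian_eq [DecidableEq τ] {f : FormalFun k τ τ} (hf : par f = f) :
    laplacian f = ∑ a, oddDeriv a (evenDeriv a f) := by
  rw [laplacian, divergence_hamiltonian hf, smul_smul, one_div,
    inv_mul_cancel₀ (two_ne_zero : (2 : k) ≠ 0), one_smul]

theorem antibracket_comm {f g : FormalFun k τ τ} (hf : par f = f) (hg : par g = g) :
    antibracket f g = antibracket g f := by
  rw [antibracket, antibracket, hamiltonian_apply hf, hamiltonian_apply hg, add_comm]
  congr 1
  · exact Finset.sum_congr rfl fun a _ => even_mul_comm (par_evenDeriv_of_even hf a) _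
  · exact Finset.sum_congr rfl fun a _ => (even_mul_comm (par_evenDeriv_of_even hg a) _).symm

theorem antibracket_self {f : FormalFun k τ τ} (hf : par f = f) :
    antibracket f f = (2 : k) • ∑ a, oddDeriv a f * evenDeriv a f := by
  rw [antibracket, hamiltonian_apply hf, two_smul]
  congr 1
  exact Finset.sum_congr rfl fun a _ => even_mul_comm (par_evenDeriv_of_even hf a) _

/-- The sum on the right is `½{f, f}`; applying the Leibniz rule to it produces the two halves of
`X_f`. With its odd counterpart this is the coordinate form of `X_f² = ½ X_{f,f}`. -/
theorem hamiltonian_evenDeriv {f : FormalFun k τ τ} (hf : par f = f) (b : τ) :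
    hamiltonian f (evenDeriv b f) = evenDeriv b (∑ a, oddDeriv a f * evenDeriv a f) := by
  rw [hamiltonian_apply hf, map_sum, ← Finset.sum_add_distrib]
  refine Finset.sum_congr rfl fun a _ => ?_
  rw [evenDeriv_mul, even_mul_comm (par_evenDeriv_of_even hf a), evenDeriv_oddDeriv,
    evenDeriv_comm b a, add_comm]

theorem hamiltonian_oddDeriv {f : FormalFun k τ τ} (hf : par f = f) (b : τ) :
    hamiltonian f (oddDeriv b f) = -oddDeriv b (∑ a, oddDeriv a f * evenDeriv a f) := by
  rw [hamiltonian_apply hf, map_sum, ← Finset.sum_add_distrib, ← Finset.sum_neg_distrib]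
  refine Finset.sum_congr rfl fun a _ => ?_
  rw [oddDeriv_mul, even_mul_comm (par_evenDeriv_of_even hf a), par_oddDeriv_of_even hf,
    oddDeriv_comm b a, evenDeriv_oddDeriv]
  noncomm_ring

theorem hamiltonian_comp_self [DecidableEq τ] {f : FormalFun k τ τ} (hf : par f = f)
    (h : ∑ a, oddDeriv a f * evenDeriv a f = 0) : hamiltonian f ∘ₗ hamiltonian f = 0 := by
  refine (isOddDerivation_hamiltonian hf).comp_self_eq_zero (fun a => ?_) (fun a => ?_)
  · rw [hamiltonian_evenCoord, hamiltonian_oddDeriv hf, h, map_zero, neg_zero]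
  · rw [hamiltonian_oddCoord hf, hamiltonian_evenDeriv hf, h, map_zero]

end Hamiltonian

/-! ### The Hamiltonian of the odd double -/

/-- In every conjugate pair one coordinate is a momentum, on which pulled-back functions do not
depend. -/
theorem sum_oddDeriv_mul_evenDeriv_inclL {k ι κ : Type*} [Field k] [Fintype ι] [Fintype κ]
    (f g : FormalFun k ι κ) :
    ∑ s, oddDeriv s (inclL f) * evenDeriv s (inclL g) = 0 := by
  simp [Fintype.sum_sum_type, evenDeriv_inl_inclL, oddDeriv_inr_inclL]

theorem antibracket_inclL {k ι κ : Type*} [Field k] [CharZero k] [Fintype ι]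
    [Fintype κ] {f : FormalFun k ι κ} (hf : par f = f) :
    antibracket (inclL f) (inclL f) = 0 := by
  rw [antibracket_self (by rw [par_inclL, hf]), sum_oddDeriv_mul_evenDeriv_inclL, smul_zero]

theorem doubleBasis₁_repr_inl {k ι κ V₀ V₁ : Type*} [Field k] [AddCommGroup V₀]
    [Module k V₀] [AddCommGroup V₁] [Module k V₁] [Fintype ι] [DecidableEq ι]
    (b₀ : Module.Basis ι k V₀) (b₁ : Module.Basis κ k V₁)
    (w : V₁ × Module.Dual k V₀) (i : ι) :
    (doubleBasis₁ b₀ b₁).repr w (Sum.inl i) = w.2 (b₀ i) := by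
  rw [doubleBasis₁, Module.Basis.repr_reindex_apply]
  simp

theorem doubleBasis₁_repr_inr {k ι κ V₀ V₁ : Type*} [Field k] [AddCommGroup V₀]
    [Module k V₀] [AddCommGroup V₁] [Module k V₁] [Fintype ι] [DecidableEq ι]
    (b₀ : Module.Basis ι k V₀) (b₁ : Module.Basis κ k V₁)
    (w : V₁ × Module.Dual k V₀) (j : κ) :
    (doubleBasis₁ b₀ b₁).repr w (Sum.inr j) = b₁.repr w.1 j := by
  rw [doubleBasis₁, Module.Basis.repr_reindex_apply]
  simp

section OddDouble

variable {k ι κ : Type*} [Field k] [Fintype ι] [Fintype κ] [DecidableEq ι] [DecidableEq κ]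
  {m : FormalFun k ι κ →ₗ[k] FormalFun k ι κ}

theorem oddDouble_add (m m' : FormalFun k ι κ →ₗ[k] FormalFun k ι κ) :
    oddDouble (m + m') = oddDouble m + oddDouble m' := by
  simp only [oddDouble, ← inclL_apply, LinearMap.add_apply, map_add, add_mul,
    Finset.sum_add_distrib]
  abel

theorem oddDouble_eq (hm : IsOddDerivation m) :
    oddDouble m = -∑ j, inclL (m (evenCoord j)) * oddCoord (Sum.inr j)
      + ∑ i, inclL (m (oddCoord i)) * evenCoord (Sum.inl i) := by
  simp only [oddDouble, ← inclL_apply, hm.par_evenCoord, hm.par_oddCoord, map_neg, neg_mul,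
    Finset.sum_neg_distrib]

theorem par_oddDouble (hm : IsOddDerivation m) : par (oddDouble m) = oddDouble m := by
  simp only [oddDouble_eq hm, map_add, map_neg, map_sum, par_mul, par_inclL, hm.par_evenCoord,
    hm.par_oddCoord, par_oddCoord, par_evenCoord, neg_mul_neg]

theorem oddDeriv_inr_oddDouble (hm : IsOddDerivation m) (j : κ) :
    oddDeriv (Sum.inr j) (oddDouble m) = inclL (m (evenCoord j)) := by
  simp only [oddDouble_eq hm, map_add, map_neg, map_sum, oddDeriv_mul, par_inclL,
    hm.par_evenCoord, oddDeriv_inr_inclL, oddDeriv_oddCoord, oddDeriv_evenCoord, zero_mul,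
    mul_zero, zero_add, Finset.sum_const_zero, add_zero, Sum.inr.injEq, mul_ite, mul_one]
  simp

theorem evenDeriv_inl_oddDouble (hm : IsOddDerivation m) (i : ι) :
    evenDeriv (Sum.inl i) (oddDouble m) = inclL (m (oddCoord i)) := by
  simp only [oddDouble_eq hm, map_add, map_neg, map_sum, evenDeriv_mul,
    evenDeriv_inl_inclL, evenDeriv_oddCoord, evenDeriv_evenCoord, zero_mul,
    mul_zero, zero_add, Finset.sum_const_zero, add_zero, Sum.inl.injEq, mul_ite, mul_one]
  simp

theorem evenDeriv_inr_oddDouble (hm : IsOddDerivation m) (j : κ) :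
    evenDeriv (Sum.inr j) (oddDouble m)
      = -∑ j', inclL (evenDeriv j (m (evenCoord j'))) * oddCoord (Sum.inr j')
        + ∑ i, inclL (evenDeriv j (m (oddCoord i))) * evenCoord (Sum.inl i) := by
  simp [oddDouble_eq hm, evenDeriv_mul, evenDeriv_inr_inclL, evenDeriv_oddCoord,
    evenDeriv_evenCoord]

theorem oddDeriv_inl_oddDouble (hm : IsOddDerivation m) (i : ι) :
    oddDeriv (Sum.inl i) (oddDouble m)
      = -∑ j, inclL (oddDeriv i (m (evenCoord j))) * oddCoord (Sum.inr j)
        + ∑ i', inclL (oddDeriv i (m (oddCoord i'))) * evenCoord (Sum.inl i') := by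
  simp [oddDouble_eq hm, oddDeriv_mul, oddDeriv_inl_inclL, oddDeriv_oddCoord,
    oddDeriv_evenCoord]

theorem oddDouble_mem_orderGE (n : ℕ) (hm : DerGE n m) : oddDouble m ∈ orderGE (n + 1) := by
  refine Submodule.add_mem _ (Submodule.sum_mem _ fun j _ => ?_)
    (Submodule.sum_mem _ fun i _ => ?_)
  · exact mul_mem_orderGE (inclL_mem_orderGE (par_mem_orderGE (hm.1 j))) (oddCoord_mem_orderGE _)
  · exact mul_mem_orderGE (inclL_mem_orderGE (par_mem_orderGE (hm.2 i))) (evenCoord_mem_orderGE _)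

theorem laplacian_inclL [CharZero k] {f : FormalFun k ι κ} (hf : par f = f) :
    laplacian (inclL f) = 0 := by
  rw [laplacian_eq (by rw [par_inclL, hf])]
  simp [Fintype.sum_sum_type, evenDeriv_inl_inclL, evenDeriv_inr_inclL, oddDeriv_inr_inclL]

variable [CharZero k]

/-- Only the components along the base coordinates act on a pulled-back function, and these
components are `m(z)`. -/
theorem hamiltonian_oddDouble_inclL (hm : IsOddDerivation m) (f : FormalFun k ι κ) :
    hamiltonian (oddDouble m) (inclL f) = inclL (m f) := by
  rw [hamiltonian_apply (par_oddDouble hm), hm.apply_eq f]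
  simp [Fintype.sum_sum_type, evenDeriv_inl_inclL, oddDeriv_inr_inclL, evenDeriv_inr_inclL,
    oddDeriv_inl_inclL, oddDeriv_inr_oddDouble hm, evenDeriv_inl_oddDouble hm, inclL_mul]

/-- In each pair the momentum derivative extracts the component `m(z)`, and the other one
differentiates it along `z`. -/
theorem laplacian_oddDouble (hm : IsOddDerivation m) :
    laplacian (oddDouble m) = inclL (divergence m) := by
  rw [laplacian_eq (par_oddDouble hm), divergence, Fintype.sum_sum_type, add_comm, map_add,
    map_sum, map_sum]
  congr 1
  · refine Finset.sum_congr rfl fun j _ => ?_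
    rw [← evenDeriv_oddDeriv, oddDeriv_inr_oddDouble hm, evenDeriv_inr_inclL]
  · refine Finset.sum_congr rfl fun i _ => ?_
    rw [evenDeriv_inl_oddDouble hm, oddDeriv_inl_inclL, hm.par_oddCoord]

/-- The components along the momenta are themselves linear in the momenta, so they vanish on the
zero section. -/
theorem restrict_hamiltonian_oddDouble (hm : IsOddDerivation m)
    (F : FormalFun k (ι ⊕ κ) (ι ⊕ κ)) :
    restrict (hamiltonian (oddDouble m) F) = m (restrict F) := by
  rw [hamiltonian_apply (par_oddDouble hm), hm.apply_eq (restrict F)]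
  simp [Fintype.sum_sum_type, restrict_mul, oddDeriv_inr_oddDouble hm,
    evenDeriv_inl_oddDouble hm, evenDeriv_inr_oddDouble hm, oddDeriv_inl_oddDouble hm,
    restrict_inclL, restrict_evenDeriv_inr, restrict_oddDeriv_inl, restrict_evenCoord_inl,
    restrict_oddCoord_inr]

theorem sum_oddDeriv_mul_evenDeriv_oddDouble (hm : IsOddDerivation m) (h : m ∘ₗ m = 0) :
    ∑ s, oddDeriv s (oddDouble m) * evenDeriv s (oddDouble m) = 0 := by
  have hx : ∀ j, m (m (evenCoord j)) = 0 := fun j => LinearMap.congr_fun h _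
  have hy : ∀ i, m (m (oddCoord i)) = 0 := fun i => LinearMap.congr_fun h _
  have hcomm : ∀ i, oddDeriv (Sum.inl i) (oddDouble m) * evenDeriv (Sum.inl i) (oddDouble m)
      = inclL (m (oddCoord i)) * oddDeriv (Sum.inl i) (oddDouble m) := fun i => by
    rw [← even_mul_comm (par_evenDeriv_of_even (par_oddDouble hm) _),
      evenDeriv_inl_oddDouble hm]
  -- This is `m f = 0` expanded in coordinates, pulled back and multiplied by a momentum `p`. It is
  -- used with `f = m(z)`: `e1` collects the odd momenta and `e2` the even ones.
  have key : ∀ (f : FormalFun k ι κ) (p : FormalFun k (ι ⊕ κ) (ι ⊕ κ)), m f = 0 →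
      ∑ i, inclL (m (oddCoord i)) * (inclL (oddDeriv i f) * p)
        + ∑ j, inclL (m (evenCoord j)) * (inclL (evenDeriv j f) * p) = 0 := fun f p hf => by
    simp only [← mul_assoc, ← inclL_mul, ← Finset.sum_mul, ← map_sum, ← add_mul, ← map_add]
    rw [add_comm, ← hm.apply_eq, hf, map_zero, zero_mul]
  rw [Fintype.sum_sum_type, Finset.sum_congr rfl fun i _ => hcomm i]
  simp only [oddDeriv_inr_oddDouble hm, evenDeriv_inr_oddDouble hm,
    oddDeriv_inl_oddDouble hm, mul_add, mul_neg, Finset.mul_sum, Finset.sum_add_distrib,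
    Finset.sum_neg_distrib]
  have e1 : ∑ i, ∑ j, inclL (m (oddCoord i)) *
        (inclL (oddDeriv i (m (evenCoord j))) * oddCoord (Sum.inr j))
      + ∑ j', ∑ j, inclL (m (evenCoord j')) *
        (inclL (evenDeriv j' (m (evenCoord j))) * oddCoord (Sum.inr j)) = 0 := by
    refine (congrArg₂ (· + ·) Finset.sum_comm Finset.sum_comm).trans ?_
    rw [← Finset.sum_add_distrib]
    exact Finset.sum_eq_zero fun j _ => key _ _ (hx j)
  have e2 : ∑ i', ∑ i, inclL (m (oddCoord i')) *
        (inclL (oddDeriv i' (m (oddCoord i))) * evenCoord (Sum.inl i))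
      + ∑ j, ∑ i, inclL (m (evenCoord j)) *
        (inclL (evenDeriv j (m (oddCoord i))) * evenCoord (Sum.inl i)) = 0 := by
    refine (congrArg₂ (· + ·) Finset.sum_comm Finset.sum_comm).trans ?_
    rw [← Finset.sum_add_distrib]
    exact Finset.sum_eq_zero fun i _ => key _ _ (hy i)
  rw [eq_neg_of_add_eq_zero_left e1, eq_neg_of_add_eq_zero_left e2]
  abel

variable {V₀ V₁ : Type*} [AddCommGroup V₀] [Module k V₀] [AddCommGroup V₁] [Module k V₁]

/-- Both sides are odd vector fields, so their components are compared. The minus sign in the dual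
part of `doubleDifferential` matches the sign of the odd-momentum terms of `D`. -/
theorem lieD_doubleDifferential (d : Differential k V₀ V₁) (b₀ : Module.Basis ι k V₀)
    (b₁ : Module.Basis κ k V₁) :
    lieD (doubleDifferential d) (doubleBasis₀ b₀ b₁) (doubleBasis₁ b₀ b₁)
      = hamiltonian (oddDouble (lieD d b₀ b₁)) := by
  have hd := isOddDerivation_lieD d b₀ b₁
  rw [(isOddDerivation_hamiltonian (par_oddDouble hd)).eq_vectorField, lieD]
  congr 1
  · funext s
    rw [hamiltonian_evenCoord]
    rcases s with i | j
    · rw [oddDeriv_inl_oddDouble hd]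
      simp [lieD_evenCoord, lieD_oddCoord, oddDeriv_oddCoord, oddDeriv_evenCoord,
        Fintype.sum_sum_type, doubleBasis₀, doubleBasis₁_repr_inl, doubleDifferential, inclL_one]
    · rw [oddDeriv_inr_oddDouble hd]
      simp [lieD_evenCoord, Fintype.sum_sum_type, doubleBasis₀, doubleBasis₁_repr_inr,
        doubleDifferential,
        inclL_oddCoord]
  · funext s
    rw [hamiltonian_oddCoord (par_oddDouble hd)]
    rcases s with i | j
    · rw [evenDeriv_inl_oddDouble hd]
      simp [lieD_oddCoord, Fintype.sum_sum_type, doubleBasis₀, doubleBasis₁, doubleDifferential,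
        inclL_evenCoord]
    · rw [evenDeriv_inr_oddDouble hd]
      simp [lieD_evenCoord, lieD_oddCoord, evenDeriv_oddCoord, evenDeriv_evenCoord,
        Fintype.sum_sum_type, doubleBasis₀, doubleBasis₁, doubleDifferential, inclL_one]

end OddDouble

/-! ### Master equations on the double and the three implications -/

theorem IsLInfinity.add_lieD_comp_self {k V₀ V₁ ι κ : Type*} [Field k] [CharZero k]
    [AddCommGroup V₀] [Module k V₀] [AddCommGroup V₁] [Module k V₁] [Fintype ι] [DecidableEq ι]
    [Fintype κ] {b₀ : Module.Basis ι k V₀} {b₁ : Module.Basis κ k V₁} {d : Differential k V₀ V₁}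
    {m : FormalFun k ι κ →ₗ[k] FormalFun k ι κ} (hm : IsLInfinity d b₀ b₁ m) :
    (lieD d b₀ b₁ + m) ∘ₗ (lieD d b₀ b₁ + m) = 0 := by
  have h := hm.maurerCartan
  rw [LinearMap.add_comp, LinearMap.comp_add, LinearMap.comp_add, lieD_comp_lieD, zero_add,
    ← add_assoc, h]

section Main

variable {k V₀ V₁ ι κ : Type*} [Field k] [CharZero k] [AddCommGroup V₀] [Module k V₀]
  [AddCommGroup V₁] [Module k V₁] [Fintype ι] [DecidableEq ι] [Fintype κ] [DecidableEq κ]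
  {b₀ : Module.Basis ι k V₀} {b₁ : Module.Basis κ k V₁} {d : Differential k V₀ V₁}
  {m : FormalFun k ι κ →ₗ[k] FormalFun k ι κ}

theorem lieD_add_hamiltonian_oddDouble :
    lieD (doubleDifferential d) (doubleBasis₀ b₀ b₁) (doubleBasis₁ b₀ b₁)
      + hamiltonian (oddDouble m) = hamiltonian (oddDouble (lieD d b₀ b₁ + m)) := by
  rw [lieD_doubleDifferential, oddDouble_add, hamiltonian_add]

/-- The odd double of an `L∞` structure is an `L∞` structure. -/
theorem IsLInfinity.hamiltonian_oddDouble (hm : IsLInfinity d b₀ b₁ m) :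
    IsLInfinity (doubleDifferential d) (doubleBasis₀ b₀ b₁) (doubleBasis₁ b₀ b₁)
      (hamiltonian (oddDouble m)) := by
  have hD := par_oddDouble hm.derivation
  have hord := oddDouble_mem_orderGE 2 hm.order
  refine ⟨isOddDerivation_hamiltonian hD, ⟨fun s => ?_, fun s => ?_⟩, ?_⟩
  · rw [hamiltonian_evenCoord]
    exact oddDeriv_mem_orderGE s hord
  · rw [hamiltonian_oddCoord hD]
    exact evenDeriv_mem_orderGE s hord
  · have hM := (isOddDerivation_lieD d b₀ b₁).add hm.derivation
    -- The Hamiltonian field of `D(d + m)` squares to zero; expanding this and dropping the square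
    -- of the differential leaves the Maurer-Cartan equation.
    have h := hamiltonian_comp_self (par_oddDouble hM)
      (sum_oddDeriv_mul_evenDeriv_oddDouble hM hm.add_lieD_comp_self)
    rw [← lieD_add_hamiltonian_oddDouble, LinearMap.add_comp, LinearMap.comp_add,
      LinearMap.comp_add, lieD_comp_lieD, zero_add, ← add_assoc] at h
    exact h

/-- The classical master equation for the Hamiltonian of the odd double. -/
theorem IsLInfinity.master_oddDouble (hm : IsLInfinity d b₀ b₁ m) :
    lieD (doubleDifferential d) (doubleBasis₀ b₀ b₁) (doubleBasis₁ b₀ b₁) (oddDouble m)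
      + (1 / 2 : k) • antibracket (oddDouble m) (oddDouble m) = 0 := by
  have hd := isOddDerivation_lieD d b₀ b₁
  have hM := hd.add hm.derivation
  have h1 := antibracket_self (par_oddDouble hM)
  rw [sum_oddDeriv_mul_evenDeriv_oddDouble hM hm.add_lieD_comp_self, smul_zero] at h1
  have h2 := antibracket_self (par_oddDouble hd)
  rw [sum_oddDeriv_mul_evenDeriv_oddDouble hd (lieD_comp_lieD d b₀ b₁), smul_zero] at h2
  have h3 := antibracket_comm (par_oddDouble hd) (par_oddDouble hm.derivation)
  unfold antibracket at h1 h2 h3 ⊢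
  -- Polarization of `{D(d+m), D(d+m)} = 0`: the `D(d)` square drops out and the two mixed brackets
  -- coincide, which leaves twice the master equation.
  rw [oddDouble_add, hamiltonian_add, LinearMap.add_apply, map_add, map_add, h2, zero_add, ← h3,
    ← add_assoc, ← two_smul k] at h1
  rw [lieD_doubleDifferential]
  have := congrArg ((1 / 2 : k) • ·) h1
  simpa [smul_smul] using this

theorem restrict_lieD_doubleDifferential (F : FormalFun k (ι ⊕ κ) (ι ⊕ κ)) :
    restrict (lieD (doubleDifferential d) (doubleBasis₀ b₀ b₁) (doubleBasis₁ b₀ b₁) F)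
      = lieD d b₀ b₁ (restrict F) := by
  rw [lieD_doubleDifferential, restrict_hamiltonian_oddDouble (isOddDerivation_lieD d b₀ b₁)]

theorem lieD_doubleDifferential_inclL (f : FormalFun k ι κ) :
    lieD (doubleDifferential d) (doubleBasis₀ b₀ b₁) (doubleBasis₁ b₀ b₁) (inclL f)
      = inclL (lieD d b₀ b₁ f) := by
  rw [lieD_doubleDifferential, hamiltonian_oddDouble_inclL (isOddDerivation_lieD d b₀ b₁)]

theorem HasUnimodularLift.hasQuantumLift (h : HasUnimodularLift d b₀ b₁ m) :
    HasQuantumLift (doubleDifferential d) (doubleBasis₀ b₀ b₁) (doubleBasis₁ b₀ b₁)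
      (hamiltonian (oddDouble m)) := by
  obtain ⟨f, hm, hf, hord, heq⟩ := h
  have hD := par_oddDouble hm.derivation
  have hf2 : par ((2 : k) • f) = (2 : k) • f := by rw [map_smul, hf]
  have hF : par (inclL ((2 : k) • f)) = inclL ((2 : k) • f) := by rw [par_inclL, hf2]
  -- The factor 2 is forced: `Δ D(m)` contributes `∇m`, whereas the equation for `f` contains `½∇m`.
  let S : ℕ → FormalFun k (ι ⊕ κ) (ι ⊕ κ)
    | 0 => oddDouble m
    | 1 => inclL ((2 : k) • f)
    | _ + 2 => 0
  refine ⟨PowerSeries.mk S, ⟨fun g => ?_, fun g => ?_, PowerSeries.ext fun n => ?_⟩, ?_⟩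
  · rw [PowerSeries.coeff_mk]
    rcases g with _ | _ | g
    · exact hD
    · exact hF
    · exact map_zero par
  · rw [PowerSeries.coeff_mk]
    rcases g with _ | _ | g
    · exact oddDouble_mem_orderGE 2 hm.order
    · exact inclL_mem_orderGE (Submodule.smul_mem _ _ hord)
    · exact Submodule.zero_mem _
  · have hsmul : ∀ T : PowerSeries (FormalFun k (ι ⊕ κ) (ι ⊕ κ)),
        PowerSeries.coeff n ((1 / 2 : k) • T) = (1 / 2 : k) • PowerSeries.coeff n T := fun _ => rfl
    rw [map_add, map_add, hsmul, antibracketH, PowerSeries.coeff_mk, PowerSeries.coeff_mk, map_zero]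
    simp only [PowerSeries.coeff_mk]
    rcases n with _ | _ | _ | n
    · rw [PowerSeries.coeff_zero_X_mul, add_zero, Finset.Nat.antidiagonal_zero,
        Finset.sum_singleton]
      exact hm.master_oddDouble
    · rw [PowerSeries.coeff_succ_X_mul, PowerSeries.coeff_mk, Finset.Nat.sum_antidiagonal_succ,
        Finset.Nat.antidiagonal_zero, Finset.sum_singleton]
      change lieD _ _ _ (inclL ((2 : k) • f)) + laplacian (oddDouble m) + (1 / 2 : k) •
        (antibracket (oddDouble m) (inclL ((2 : k) • f))
          + antibracket (inclL ((2 : k) • f)) (oddDouble m)) = 0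
      rw [antibracket_comm hF hD, ← two_smul k, smul_smul, one_div,
        inv_mul_cancel₀ (two_ne_zero : (2 : k) ≠ 0), one_smul, antibracket,
        hamiltonian_oddDouble_inclL hm.derivation, laplacian_oddDouble hm.derivation,
        lieD_doubleDifferential_inclL, ← map_add, ← map_add, map_smul, map_smul]
      have := congrArg ((2 : k) • ·) heq
      simp only [smul_add, smul_smul, smul_zero, one_div,
        mul_inv_cancel₀ (two_ne_zero : (2 : k) ≠ 0), one_smul] at this
      rw [this, map_zero]
    · rw [PowerSeries.coeff_succ_X_mul, PowerSeries.coeff_mk, Finset.Nat.sum_antidiagonal_succ,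
        Finset.Nat.sum_antidiagonal_succ, Finset.Nat.antidiagonal_zero, Finset.sum_singleton]
      change lieD _ _ _ 0 + laplacian (inclL ((2 : k) • f)) + (1 / 2 : k) •
        (antibracket (oddDouble m) 0 +
          (antibracket (inclL ((2 : k) • f)) (inclL ((2 : k) • f))
            + antibracket 0 (oddDouble m))) = 0
      -- At order `h²` only terms in the pullback of `2f` alone could survive, and they vanish
      -- because it contains no momenta.
      rw [laplacian_inclL hf2, antibracket_inclL hf2, antibracket_zero_left,
        antibracket_zero_right, map_zero]
      simp only [add_zero, smul_zero]
    · rw [PowerSeries.coeff_succ_X_mul, PowerSeries.coeff_mk, Finset.sum_eq_zero, smul_zero,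
        add_zero]
      · change lieD _ _ _ 0 + laplacian 0 = 0
        rw [map_zero, zero_add, laplacian, hamiltonian_zero]
        simp [divergence]
      · intro p hp
        rw [Finset.HasAntidiagonal.mem_antidiagonal] at hp
        obtain ⟨p, q⟩ := p
        rcases p with _ | _ | p
        · obtain rfl : q = n + 3 := by simpa using hp
          exact antibracket_zero_right _
        · obtain rfl : q = n + 2 := by simp only at hp; omega
          exact antibracket_zero_right _
        · exact antibracket_zero_left _
  · rw [PowerSeries.coeff_mk]

theorem HasQuantumLift.hasUnimodularLift {τ W₀ W₁ : Type*} [AddCommGroup W₀] [Module k W₀]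
    [AddCommGroup W₁] [Module k W₁] [Fintype τ] [DecidableEq τ] {d : Differential k W₀ W₁}
    {b₀ : Module.Basis τ k W₀} {b₁ : Module.Basis τ k W₁}
    {m : FormalFun k τ τ →ₗ[k] FormalFun k τ τ} (hm : IsLInfinity d b₀ b₁ m)
    (h : HasQuantumLift d b₀ b₁ m) : HasUnimodularLift d b₀ b₁ m := by
  obtain ⟨S, hS, rfl⟩ := h
  -- In genus one the weight bound `3 - 2 * 1` is exactly the bound 1 required of a unimodular lift.
  refine ⟨PowerSeries.coeff 1 S, hm, hS.even 1, hS.weight 1, ?_⟩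
  have h := congrArg (PowerSeries.coeff (0 + 1)) hS.master
  have hsmul : ∀ T : PowerSeries (FormalFun k τ τ),
      PowerSeries.coeff (0 + 1) ((1 / 2 : k) • T)
        = (1 / 2 : k) • PowerSeries.coeff (0 + 1) T := fun _ => rfl
  rw [map_add, map_add, hsmul, antibracketH, PowerSeries.coeff_mk, PowerSeries.coeff_mk, map_zero,
    PowerSeries.coeff_succ_X_mul, PowerSeries.coeff_mk,
    Finset.Nat.sum_antidiagonal_succ, Finset.Nat.antidiagonal_zero, Finset.sum_singleton] at h
  simp only [zero_add] at h
  rwa [antibracket_comm (hS.even 1) (hS.even 0), ← two_smul k, smul_smul, one_div,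
    inv_mul_cancel₀ (two_ne_zero : (2 : k) ≠ 0), one_smul, laplacian] at h

theorem HasUnimodularLift.of_oddDouble (hm : IsLInfinity d b₀ b₁ m)
    (h : HasUnimodularLift (doubleDifferential d) (doubleBasis₀ b₀ b₁) (doubleBasis₁ b₀ b₁)
      (hamiltonian (oddDouble m))) : HasUnimodularLift d b₀ b₁ m := by
  obtain ⟨F, -, hF, hord, heq⟩ := h
  -- Restricting the equation of `F` leaves `∇m` with coefficient 1, so halving gives the required
  -- `½∇m`.
  refine ⟨(1 / 2 : k) • restrict F, hm, ?_, Submodule.smul_mem _ _ (restrict_mem_orderGE hord), ?_⟩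
  · rw [IsEvenFun, map_smul, ← restrict_par, hF]
  · have := congrArg restrict heq
    -- The half divergence of the Hamiltonian field is the Laplacian by definition.
    change restrict (_ + laplacian (oddDouble m) + _) = _ at this
    rw [laplacian_oddDouble hm.derivation, map_add, map_add, restrict_lieD_doubleDifferential,
      restrict_inclL, restrict_hamiltonian_oddDouble hm.derivation, map_zero] at this
    rw [map_smul, map_smul, ← smul_add, ← smul_add, this, smul_zero]

end Main

end LInf

end

theorem theorem6p4 {k V₀ V₁ ι κ : Type*} [Field k] [CharZero k]
    [AddCommGroup V₀] [Module k V₀] [AddCommGroup V₁] [Module k V₁]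
    [Fintype ι] [DecidableEq ι] [Fintype κ] [DecidableEq κ]
    (b₀ : Module.Basis ι k V₀) (b₁ : Module.Basis κ k V₁)
    (d : LInf.Differential k V₀ V₁)
    (m : LInf.FormalFun k ι κ →ₗ[k] LInf.FormalFun k ι κ)
    (hm : LInf.IsLInfinity d b₀ b₁ m) :
    [ LInf.HasUnimodularLift d b₀ b₁ m,
      LInf.HasUnimodularLift (LInf.doubleDifferential d)
        (LInf.doubleBasis₀ b₀ b₁) (LInf.doubleBasis₁ b₀ b₁)
        (LInf.hamiltonian (LInf.oddDouble m)),
      LInf.HasQuantumLift (LInf.doubleDifferential d)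
        (LInf.doubleBasis₀ b₀ b₁) (LInf.doubleBasis₁ b₀ b₁)
        (LInf.hamiltonian (LInf.oddDouble m)) ].TFAE := by
  tfae_have 1 → 3 := fun h => h.hasQuantumLift
  tfae_have 3 → 2 := fun h => h.hasUnimodularLift hm.hamiltonian_oddDouble
  tfae_have 2 → 1 := fun h => h.of_oddDouble hm
  tfae_finish
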